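/- All graphs are finite, undirected and simple. Let $G$ be a graph and $S\subseteq V(G)$ a set of at least two vertices. An $S$-tree is a subgraph $T$ of $G$ that is a tree with $S\subseteq V(T)$. Two $S$-trees $T,T'$ are internally disjoint if $E(T)\cap E(T')=\varnothing$ and $V(T)\cap V(T')=S$. Let $\kappa(S)$ be the maximum number of pairwise internally disjoint $S$-trees in $G$. The generalized $3$-connectivity of $G$ is $\kappa_3(G)=\min\{\kappa(S): S\subseteq V(G),\ |S|=3\}$ if $G$ is connected and has at least three vertices, $\kappa_3(G)=1$ if $G$ is connected with fewer than three vertices, and $\kappa_3(G)=0$ if $G$ is disconnected. The lexicographic product $G\circ H$ has vertex set $V(G)\times V(H)$, and $(u,v)$, $(u',v')$ are adjacent if and only if $uu'\in E(G)$, or $u=u'$ and $vv'\in E(H)$. **Theorem 1.11.** Let $G$ and $H$ be two connected graphs, where $G$ is nontrivial (it has at least two vertices). Then $$\kappa_3(G\circ H)\ \ge\ \kappa_3(G)\,|V(H)|.$$ Moreover, the bound is sharp: writing $P_n$ for the path and $K_n$ for the complete graph on $n$ vertices, $$\kappa_3(P_n\circ P_3)=\kappa_3(P_n)\,|V(P_3)|=3\quad\text{for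 all } n\ge 4,$$ $$\kappa_3(P_n\circ K_m)=\kappa_3(P_n)\,|V(K_m)|=m\quad\text{for all } n\ge 3,\ m\ge 1.$$ -/

import Mathlib

namespace SteinerConn

variable {V W : Type*}

/-- The lexicographic product `G ∘ H`: the vertex set is `V × W`, and `(u, v)`, `(u', v')` are
adjacent iff `u u'` is an edge of `G`, or `u = u'` and `v v'` is an edge of `H`. -/
def lexProd (G : SimpleGraph V) (H : SimpleGraph W) : SimpleGraph (V × W) where
  Adj p q := G.Adj p.1 q.1 ∨ (p.1 = q.1 ∧ H.Adj p.2 q.2)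
  symm := ⟨by
    rintro p q (h | ⟨h, h'⟩)
    · exact Or.inl h.symm
    · exact Or.inr ⟨h.symm, h'.symm⟩⟩
  loopless := ⟨by
    rintro p (h | ⟨-, h⟩)
    · exact G.loopless.irrefl _ h
    · exact H.loopless.irrefl _ h⟩

/-- `T` is an `S`-tree of `G`: a subgraph of `G` which is a tree and whose vertex set
contains `S`. -/
def IsSteinerTree {G : SimpleGraph V} (S : Set V) (T : G.Subgraph) : Prop :=
  T.coe.IsTree ∧ S ⊆ T.verts

/-- Two `S`-trees are internally disjoint: they have no common edge, and their common vertices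
are exactly those of `S`. -/
def InternallyDisjoint {G : SimpleGraph V} (S : Set V) (T T' : G.Subgraph) : Prop :=
  T.edgeSet ∩ T'.edgeSet = ∅ ∧ T.verts ∩ T'.verts = S

/-- The generalized local connectivity `κ(S)` of a finite graph: the maximum number of pairwise
internally disjoint `S`-trees in `G` (the supremum is over a nonempty set of natural numbers
that is bounded by the number of subgraphs of `G`). -/
noncomputable def localConn [Finite V] (G : SimpleGraph V) (S : Set V) : ℕ :=
  sSup {n : ℕ | ∃ F : Finset G.Subgraph, F.card = n ∧ (∀ T ∈ F, IsSteinerTree S T) ∧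
    (F : Set G.Subgraph).Pairwise (InternallyDisjoint S)}

open scoped Classical in
/-- The generalized `k`-connectivity `κ_k(G)` of a finite graph (for `k ≥ 2`): the minimum of
`κ(S)` over the `k`-element vertex sets `S`, with the conventions that it is `1` for a connected
graph with fewer than `k` vertices and `0` for a disconnected graph. -/
noncomputable def genConn [Fintype V] (k : ℕ) (G : SimpleGraph V) : ℕ :=
  if G.Connected then
    if k ≤ Fintype.card V then
      sInf {n : ℕ | ∃ S : Finset V, S.card = k ∧ n = localConn G (S : Set V)}
    else 1
  else 0

end SteinerConn

namespace SteinerConn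

/-! Counting internally disjoint `S`-trees amounts to counting members of an `IsPacking`: connected
pieces suffice, since each contains a spanning tree. The lower bound splits according to how three
terminals of the product are spread over the layers, the sets of vertices with a common first
coordinate.

In three different layers, take `k` trees of `G` for the projected terminals and make one copy of
each at every height `h : W`, always attached to the same three terminals. Edges between layers
ignore heights, so edges that meet a nonterminal lift freely. Edges joining two terminals cannot be
shared by the copies; a copy replaces them by spare vertices above terminals. Different trees must
not want the same spare vertices, and `IsPacking.exists_layers` arranges this by maximising the
number of trees that need no inner edge.

With two terminals above `u₁` and one above `u₂`, disjoint `u₁`–`u₂` connections in `G` are copied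
at each height (`exists_packing_pair`, a Menger theorem from Hall), and an edge `u₁u₂` contributes
`|W|` further trees inside the two layers. With all terminals above one `u`, each vertex above a
neighbour of `u` is the centre of a star. The last two cases need `κ₃(G)` to be at most the relevant
cut or degree, which is `genConn_three_le_card_cut`.

For sharpness, the only way out of an end layer of a path is through the `|W|` vertices of the next
layer. -/

open SimpleGraph

variable {V W X ι : Type*}

/-! ### Packings and boundary counting -/

/-- The edges of `G` inside `S ∪ D` that have at least one end in `D`. -/
def touchGraph (G : SimpleGraph X) (S D : Set X) : SimpleGraph X where
  Adj x y := G.Adj x y ∧ x ∈ S ∪ D ∧ y ∈ S ∪ D ∧ (x ∈ D ∨ y ∈ D)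
  symm := ⟨fun _ _ h => ⟨h.1.symm, h.2.2.1, h.2.1, h.2.2.2.symm⟩⟩
  loopless := ⟨fun _ h => G.loopless.irrefl _ h.1⟩

/-- A family of internally disjoint connected subgraphs containing `S`, presented by their
vertex sets `D i` outside `S` and their edges `F i` inside `S`. -/
structure IsPacking (G : SimpleGraph X) (S : Set X) (D : ι → Set X)
    (F : ι → SimpleGraph X) : Prop where
  notMem : ∀ i, ∀ x ∈ D i, x ∉ S
  disj : ∀ i j x, x ∈ D i → x ∈ D j → i = j
  le : ∀ i x y, (F i).Adj x y → G.Adj x y ∧ x ∈ S ∧ y ∈ S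
  edgeDisj : ∀ i j x y, (F i).Adj x y → (F j).Adj x y → i = j
  conn : ∀ i, ∀ x ∈ S ∪ D i, ∀ y ∈ S ∪ D i, (touchGraph G S (D i) ⊔ F i).Reachable x y

lemma touchGraph_mono (G : SimpleGraph X) (S : Set X) {D D' : Set X} (h : D ⊆ D') :
    touchGraph G S D ≤ touchGraph G S D' := fun _ _ hxy =>
  ⟨hxy.1, Set.union_subset_union_right _ h hxy.2.1, Set.union_subset_union_right _ h hxy.2.2.1,
    hxy.2.2.2.imp (@h _) (@h _)⟩

/-- A walk leaving a vertex set uses an edge leaving it. -/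
lemma exists_boundary_adj {G : SimpleGraph X} {x y : X} (h : G.Reachable x y) (A : Set X)
    (hx : x ∈ A) (hy : y ∉ A) : ∃ p q, G.Adj p q ∧ p ∈ A ∧ q ∉ A := by
  obtain ⟨w⟩ := h
  obtain ⟨d, -, h1, h2⟩ := w.exists_boundary_dart A hx hy
  exact ⟨_, _, d.adj, h1, h2⟩

lemma reachable_all_of_base {K : SimpleGraph X} {A : Set X} (s : X)
    (h : ∀ x ∈ A, K.Reachable x s) : ∀ x ∈ A, ∀ y ∈ A, K.Reachable x y :=
  fun x hx y hy => (h x hx).trans (h y hy).symm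

namespace IsPacking

variable {G : SimpleGraph X} {S : Set X} {D : ι → Set X} {F : ι → SimpleGraph X}

lemma adj_mem (hP : IsPacking G S D F) {i : ι} {x y : X}
    (h : (touchGraph G S (D i) ⊔ F i).Adj x y) : G.Adj x y ∧ x ∈ S ∪ D i ∧ y ∈ S ∪ D i := by
  rcases h with h | h
  · exact ⟨h.1, h.2.1, h.2.2.1⟩
  · exact ⟨(hP.le _ _ _ h).1, Or.inl (hP.le _ _ _ h).2.1, Or.inl (hP.le _ _ _ h).2.2⟩

/-- An edge with an end in `D i` determines `i`, because the sets `D` are disjoint and avoid `S`; an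
edge inside `S` is governed by `edgeDisj`. -/
lemma eq_of_adj (hP : IsPacking G S D F) {i j : ι} {x y : X}
    (hi : (touchGraph G S (D i) ⊔ F i).Adj x y)
    (hj : (touchGraph G S (D j) ⊔ F j).Adj x y) : i = j := by
  have key : ∀ (i j : ι) (x : X), x ∈ D i → x ∈ S ∪ D j → i = j := fun i j x h h' =>
    h'.elim (fun h'' => absurd h'' (hP.notMem _ _ h)) (hP.disj _ _ _ h)
  have hj' := hP.adj_mem hj
  have hi' := hP.adj_mem hi
  rcases hi with hi | hi
  · exact hi.2.2.2.elim (fun h => key _ _ _ h hj'.2.1) (fun h => key _ _ _ h hj'.2.2)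
  rcases hj with hj | hj
  · exact (hj.2.2.2.elim (fun h => key _ _ _ h hi'.2.1) (fun h => key _ _ _ h hi'.2.2)).symm
  · exact hP.edgeDisj _ _ _ _ hi hj

/-- The number of members of a packing is bounded by the number of outer boundary vertices of
a set separating two vertices of `S`. -/
lemma card_le_of_boundary [Fintype ι] (hP : IsPacking G S D F) {A : Set X} {s t : X}
    (hs : s ∈ S) (ht : t ∈ S) (hsA : s ∈ A) (htA : t ∉ A) (C : Finset X)
    (hC : ∀ p ∈ A, ∀ q ∉ A, G.Adj p q → q ∈ C)
    (hu : ∀ q ∈ S, q ∉ A → ∀ p ∈ A, ∀ p' ∈ A, G.Adj p q → G.Adj p' q → p = p') :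
    Fintype.card ι ≤ C.card := by
  have h := fun i => exists_boundary_adj (hP.conn i s (Or.inl hs) t (Or.inl ht)) A hsA htA
  choose p q hpq hp hq using h
  have hinj : Function.Injective q := by
    intro i j hij
    have hi := hP.adj_mem (hpq i)
    have hj := hP.adj_mem (hpq j)
    -- An exit vertex outside `S` belongs to a single member. A terminal belongs to all of them, so
    -- there `hu` recovers the whole crossing edge, which only one member can own.
    by_cases hS : q i ∈ S
    · have hpp : p i = p j := hu _ hS (hq i) _ (hp i) _ (hp j) hi.1 (hij ▸ hj.1)
      have h2 := hpq j
      rw [← hpp, ← hij] at h2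
      exact hP.eq_of_adj (hpq i) h2
    · exact hP.disj _ _ (q i) (hi.2.2.resolve_left hS)
        ((hij ▸ hj.2.2 : q i ∈ S ∪ D j).resolve_left hS)
  rw [← Finset.card_univ]
  exact Finset.card_le_card_of_injOn q
    (fun i _ => hC _ (hp i) _ (hq i) (hP.adj_mem (hpq i)).1) hinj.injOn

/-- A component of `touchGraph` that misses `S` cannot be left by edges of `F i` either, since those
run inside `S`. -/
lemma exists_touch_reachable (hP : IsPacking G S D F) {s : X} (hs : s ∈ S) (i : ι) {d : X}
    (hd : d ∈ D i) : ∃ t ∈ S, (touchGraph G S (D i)).Reachable d t := by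
  by_contra! hcon
  obtain ⟨p, q, hpq, hp, hq⟩ := exists_boundary_adj (hP.conn i d (Or.inr hd) s (Or.inl hs))
    {v | (touchGraph G S (D i)).Reachable d v} (Reachable.refl _) (hcon s hs)
  rcases hpq with hpq | hpq
  · exact hq (Reachable.trans hp hpq.reachable)
  · exact hcon p (hP.le _ _ _ hpq).2.1 hp

/-- Where the edges outside `S` fail to connect `S`, some edge inside `S` is used. -/
lemma exists_inner_adj (hP : IsPacking G S D F) {s t : X} (hs : s ∈ S) (ht : t ∈ S) (i : ι)
    (hst : ¬ (touchGraph G S (D i)).Reachable s t) :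
    ∃ p q, (F i).Adj p q ∧ (touchGraph G S (D i)).Reachable s p ∧
      ¬ (touchGraph G S (D i)).Reachable s q := by
  obtain ⟨p, q, hpq, hp, hq⟩ := exists_boundary_adj (hP.conn i s (Or.inl hs) t (Or.inl ht))
    {v | (touchGraph G S (D i)).Reachable s v} (Reachable.refl _) hst
  rcases hpq with hpq | hpq
  · exact absurd (Reachable.trans hp hpq.reachable) hq
  · exact ⟨p, q, hpq, hp, hq⟩

end IsPacking

/-! ### Packings versus families of trees -/

lemma bddAbove_steinerTrees [Finite X] (G : SimpleGraph X) (S : Set X) :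
    BddAbove {n : ℕ | ∃ F : Finset G.Subgraph, F.card = n ∧ (∀ T ∈ F, IsSteinerTree S T) ∧
      (F : Set G.Subgraph).Pairwise (InternallyDisjoint S)} := by
  classical
  have : Fintype G.Subgraph := Fintype.ofFinite _
  refine ⟨Fintype.card G.Subgraph, ?_⟩
  rintro n ⟨F, rfl, -⟩
  exact Finset.card_le_univ F

lemma le_localConn_iff [Finite X] (G : SimpleGraph X) (S : Set X) (k : ℕ) :
    k ≤ localConn G S ↔ ∃ F : Finset G.Subgraph, F.card = k ∧ (∀ T ∈ F, IsSteinerTree S T) ∧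
      (F : Set G.Subgraph).Pairwise (InternallyDisjoint S) := by
  constructor
  · intro h
    obtain ⟨F, hF, h1, h2⟩ := Nat.sSup_mem
      (s := {n : ℕ | ∃ F : Finset G.Subgraph, F.card = n ∧ (∀ T ∈ F, IsSteinerTree S T) ∧
      (F : Set G.Subgraph).Pairwise (InternallyDisjoint S)})
      ⟨0, ∅, by simp⟩ (bddAbove_steinerTrees G S)
    obtain ⟨F', hF', hc⟩ := Finset.exists_subset_card_eq (h.trans hF.ge)
    exact ⟨F', hc, fun T hT => h1 T (hF' hT), h2.mono (by exact_mod_cast hF')⟩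
  · rintro h
    exact le_csSup (bddAbove_steinerTrees G S) h

theorem exists_packing_of_le_localConn [Finite X] {G : SimpleGraph X} {S : Set X} {k : ℕ}
    (h : k ≤ localConn G S) :
    ∃ (D : Fin k → Set X) (F : Fin k → SimpleGraph X), IsPacking G S D F := by
  obtain ⟨A, hA, hT, hd⟩ := (le_localConn_iff G S k).1 h
  let e : Fin k ≃ A := (Finset.equivFinOfCardEq hA).symm
  let T : Fin k → G.Subgraph := fun i => (e i).1
  have hdT : ∀ i j, i ≠ j → InternallyDisjoint S (T i) (T j) := fun i j hij =>
    hd (e i).2 (e j).2 (fun h => hij (e.injective (Subtype.ext h)))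
  have hST : ∀ i, S ⊆ (T i).verts := fun i => (hT _ (e i).2).2
  refine ⟨fun i => (T i).verts \ S, fun i =>
    { Adj := fun x y => (T i).Adj x y ∧ x ∈ S ∧ y ∈ S
      symm := ⟨fun x y h => ⟨h.1.symm, h.2.2, h.2.1⟩⟩
      loopless := ⟨fun x h => G.loopless.irrefl _ ((T i).adj_sub h.1)⟩ }, ?_, ?_, ?_, ?_, ?_⟩
  · exact fun i x hx => hx.2
  · intro i j x hi hj
    by_contra hij
    exact hi.2 ((hdT i j hij).2 ▸ ⟨hi.1, hj.1⟩)
  · exact fun i x y hxy => ⟨(T i).adj_sub hxy.1, hxy.2⟩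
  · intro i j x y hi hj
    by_contra hij
    have : s(x, y) ∈ (T i).edgeSet ∩ (T j).edgeSet := ⟨hi.1, hj.1⟩
    rw [(hdT i j hij).1] at this
    exact this
  · intro i x hx y hy
    have hv : ∀ v ∈ S ∪ (T i).verts \ S, v ∈ (T i).verts := by
      rintro v (hv | hv)
      exacts [hST i hv, hv.1]
    have hc := (hT _ (e i).2).1.connected.preconnected ⟨x, hv x hx⟩ ⟨y, hv y hy⟩
    refine hc.map (G' := touchGraph G S ((T i).verts \ S) ⊔ _) ⟨Subtype.val, ?_⟩
    rintro ⟨a, ha⟩ ⟨b, hb⟩ hab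
    have hab' : (T i).Adj a b := hab
    by_cases haS : a ∈ S
    · by_cases hbS : b ∈ S
      · exact Or.inr ⟨hab', haS, hbS⟩
      · exact Or.inl ⟨(T i).adj_sub hab', Or.inl haS, Or.inr ⟨hb, hbS⟩, Or.inr ⟨hb, hbS⟩⟩
    · refine Or.inl ⟨(T i).adj_sub hab', Or.inr ⟨ha, haS⟩, ?_, Or.inl ⟨ha, haS⟩⟩
      by_cases hbS : b ∈ S
      exacts [Or.inl hbS, Or.inr ⟨hb, hbS⟩]

/-- A graph whose edges lie in `A` and which connects `A` contains a tree with vertex set `A`. -/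
lemma exists_tree_subgraph {G K : SimpleGraph X} {A : Set X} [Finite X] (hne : A.Nonempty)
    (hK : ∀ x y, K.Adj x y → G.Adj x y ∧ x ∈ A ∧ y ∈ A)
    (hc : ∀ x ∈ A, ∀ y ∈ A, K.Reachable x y) :
    ∃ T : G.Subgraph, T.coe.IsTree ∧ T.verts = A ∧ ∀ x y, T.Adj x y → K.Adj x y := by
  have hconn : (K.induce A).Connected := by
    have : Nonempty A := hne.to_subtype
    refine ⟨fun x y => ?_⟩
    obtain ⟨w⟩ := hc x x.2 y y.2
    have : ∀ {a b : X} (w : K.Walk a b) (ha : a ∈ A) (hb : b ∈ A),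
        (K.induce A).Reachable ⟨a, ha⟩ ⟨b, hb⟩ := by
      intro a b w
      induction w with
      | nil => exact fun _ _ => Reachable.refl _
      | cons h p ih =>
        intro ha hb
        have h' : (K.induce A).Adj ⟨_, ha⟩ ⟨_, (hK _ _ h).2.2⟩ := h
        exact h'.reachable.trans (ih _ hb)
    exact this w x.2 y.2
  obtain ⟨T, hTK, hT⟩ := hconn.exists_isTree_le
  refine ⟨{ verts := A
            Adj := fun x y => ∃ (hx : x ∈ A) (hy : y ∈ A), T.Adj ⟨x, hx⟩ ⟨y, hy⟩
            adj_sub := fun ⟨hx, hy, h⟩ => (hK _ _ (hTK h)).1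
            edge_vert := fun ⟨hx, _, _⟩ => hx
            symm := ⟨fun _ _ ⟨hx, hy, h⟩ => ⟨hy, hx, h.symm⟩⟩ }, ?_, rfl, ?_⟩
  · convert hT using 1
    ext x y
    exact ⟨fun ⟨_, _, h⟩ => h, fun h => ⟨x.2, y.2, h⟩⟩
  · exact fun x y ⟨hx, hy, h⟩ => hTK h

theorem IsPacking.card_le_localConn [Finite X] [Fintype ι] {G : SimpleGraph X} {S : Set X}
    {D : ι → Set X} {F : ι → SimpleGraph X} (hP : IsPacking G S D F) (hS : S.Nontrivial) :
    Fintype.card ι ≤ localConn G S := by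
  classical
  have := fun i => exists_tree_subgraph (G := G) (hS.nonempty.mono Set.subset_union_left)
    (fun x y => hP.adj_mem (i := i) (x := x) (y := y)) (hP.conn i)
  choose T hT hv hadj using this
  have hST : ∀ i, S ⊆ (T i).verts := fun i => hv i ▸ Set.subset_union_left
  have hed : ∀ i j, (T i).edgeSet ∩ (T j).edgeSet ≠ ∅ → i = j := by
    intro i j h
    obtain ⟨e, h1, h2⟩ := Set.nonempty_iff_ne_empty.2 h
    induction e with
    | h x y => exact hP.eq_of_adj (hadj _ _ _ h1) (hadj _ _ _ h2)
  -- Families of trees are counted as sets, so the trees must be distinct. As `S` has two vertices,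
  -- each tree has an edge, and edges determine the index.
  have hinj : Function.Injective T := by
    intro i j hij
    apply hed
    rw [← hij, Set.inter_self]
    obtain ⟨s, hs, t, ht, hst⟩ := hS
    have hr := (hT i).connected.preconnected ⟨s, hST i hs⟩ ⟨t, hST i ht⟩
    obtain ⟨p, q, hpq, -⟩ := exists_boundary_adj hr {⟨s, hST i hs⟩} rfl
      (fun h => hst (congrArg Subtype.val h).symm)
    exact Set.nonempty_iff_ne_empty.1 ⟨s(p.1, q.1), hpq⟩
  rw [le_localConn_iff]
  refine ⟨Finset.univ.image T, ?_, ?_, ?_⟩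
  · rw [Finset.card_image_of_injective _ hinj, Finset.card_univ]
  · intro T' hT'
    obtain ⟨i, -, rfl⟩ := Finset.mem_image.1 hT'
    exact ⟨hT i, hST i⟩
  · intro T₁ h₁ T₂ h₂ hne
    obtain ⟨i, -, rfl⟩ := Finset.mem_image.1 h₁
    obtain ⟨j, -, rfl⟩ := Finset.mem_image.1 h₂
    have hij : i ≠ j := fun h => hne (h ▸ rfl)
    refine ⟨by_contra fun h => hij (hed i j h), ?_⟩
    rw [hv, hv, ← Set.union_inter_distrib_left]
    refine Set.union_eq_left.2 fun x hx => absurd (hP.disj i j x hx.1 hx.2) hij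

/-! ### Trading edges between terminals for layers -/

section Layers

variable {G : SimpleGraph V} {S : Set V} {D : ι → Set V} {F : ι → SimpleGraph V}

/-- The edges meeting `D` connect all of `S`. -/
def Spans (G : SimpleGraph V) (S D : Set V) : Prop :=
  ∀ s ∈ S, ∀ t ∈ S, (touchGraph G S D).Reachable s t

/-- `S` is connected by the edges meeting `D`, which join `y` to one other vertex of `S`,
together with an edge of `F` from `y` to the third vertex. -/
def SpansWithEdge (G : SimpleGraph V) (S D : Set V) (F : SimpleGraph V) (y : V) : Prop :=
  ∃ x z, S = {x, y, z} ∧ x ≠ y ∧ y ≠ z ∧ x ≠ z ∧ (touchGraph G S D).Reachable y z ∧ F.Adj x y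

/-- `S` is connected by two edges of `F` with common end `y`. -/
def SpansWithPath (S : Set V) (F : SimpleGraph V) (y : V) : Prop :=
  ∃ x z, S = {x, y, z} ∧ x ≠ y ∧ y ≠ z ∧ x ≠ z ∧ F.Adj x y ∧ F.Adj y z

/-- The cases follow how `touchGraph` partitions the three terminals. One class spans; with classes
of sizes two and one, an inner edge leads from the lone terminal to the pair; with three classes
every terminal lies on an inner edge, so two such edges share an end. -/
lemma IsPacking.spans_cases (hP : IsPacking G S D F) {a b c : V} (hab : a ≠ b) (hbc : b ≠ c)
    (hac : a ≠ c) (hS : S = {a, b, c}) (i : ι) :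
    Spans G S (D i) ∨ (∃ y, SpansWithEdge G S (D i) (F i) y) ∨
      ∃ y, SpansWithPath S (F i) y := by
  have key : ∀ x y z, S = {x, y, z} → x ≠ y → y ≠ z → x ≠ z →
      (touchGraph G S (D i)).Reachable y z →
      Spans G S (D i) ∨ ∃ y, SpansWithEdge G S (D i) (F i) y := by
    intro x y z hS hxy hyz hxz hr
    by_cases hr' : (touchGraph G S (D i)).Reachable x y
    · left
      refine reachable_all_of_base y ?_
      intro v hv
      rw [hS] at hv
      rcases hv with rfl | rfl | rfl
      exacts [hr', Reachable.refl _, hr.symm]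
    · right
      obtain ⟨p, q, hpq, hp, hq⟩ := hP.exists_inner_adj (s := x) (t := y) (by simp [hS])
        (by simp [hS]) i hr'
      have hpS := (hP.le _ _ _ hpq).2.1
      have hqS := (hP.le _ _ _ hpq).2.2
      rw [hS] at hpS hqS
      have hpx : p = x := by
        rcases hpS with h | h | h
        · exact h
        · exact absurd (h ▸ hp) hr'
        · exact absurd ((h ▸ hp : (touchGraph G S (D i)).Reachable x z).trans hr.symm) hr'
      subst hpx
      rcases hqS with h | h | h
      · exact absurd (h ▸ Reachable.refl _) hq
      · subst h
        exact ⟨q, p, z, hS, hxy, hyz, hxz, hr, hpq⟩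
      · rw [Set.mem_singleton_iff] at h
        subst h
        exact ⟨q, p, y, by rw [hS, Set.pair_comm], hxz, hyz.symm, hxy, hr.symm, hpq⟩
  by_cases h1 : (touchGraph G S (D i)).Reachable b c
  · exact or_assoc.1 (Or.inl (key a b c hS hab hbc hac h1))
  by_cases h2 : (touchGraph G S (D i)).Reachable a c
  · exact or_assoc.1 (Or.inl (key b a c (by rw [hS, Set.insert_comm]) hab.symm hac hbc h2))
  by_cases h3 : (touchGraph G S (D i)).Reachable a b
  · exact or_assoc.1 (Or.inl (key c a b
      (by rw [hS]; ext; simp only [Set.mem_insert_iff, Set.mem_singleton_iff]; tauto)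
      hac.symm hab hbc.symm h3))
  right; right
  have aS : a ∈ S := by simp [hS]
  have bS : b ∈ S := by simp [hS]
  have cS : c ∈ S := by simp [hS]
  have edge : ∀ s ∈ S, (∃ t ∈ S, ¬ (touchGraph G S (D i)).Reachable s t) →
      ∃ q ∈ S, (F i).Adj s q := by
    rintro s hs ⟨t, ht, hst⟩
    obtain ⟨p, q, hpq, hp, -⟩ := hP.exists_inner_adj hs ht i hst
    have hpS := (hP.le _ _ _ hpq).2.1
    have : s = p := by
      by_contra hne
      have hs' := hs
      have hp' := hp.symm
      rw [hS] at hs' hpS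
      rcases hs' with rfl | rfl | rfl <;> rcases hpS with rfl | rfl | rfl <;> tauto
    exact ⟨q, (hP.le _ _ _ hpq).2.2, this ▸ hpq⟩
  obtain ⟨q1, hq1, e1⟩ := edge a aS ⟨b, bS, h3⟩
  obtain ⟨q2, hq2, e2⟩ := edge b bS ⟨c, cS, h1⟩
  obtain ⟨q3, hq3, e3⟩ := edge c cS ⟨a, aS, fun h => h2 h.symm⟩
  have n1 := e1.ne
  have n2 := e2.ne
  have n3 := e3.ne
  have pa : (F i).Adj a b → (F i).Adj a c → ∃ y, SpansWithPath S (F i) y := fun h h' =>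
    ⟨a, b, c, by rw [hS, Set.insert_comm], hab.symm, hac, hbc, h.symm, h'⟩
  have pb : (F i).Adj a b → (F i).Adj b c → ∃ y, SpansWithPath S (F i) y := fun h h' =>
    ⟨b, a, c, hS, hab, hbc, hac, h, h'⟩
  have pc : (F i).Adj a c → (F i).Adj b c → ∃ y, SpansWithPath S (F i) y := fun h h' =>
    ⟨c, a, b, by rw [hS, Set.pair_comm], hac, hbc.symm, hab, h, h'.symm⟩
  rw [hS] at hq1 hq2 hq3
  rcases hq1 with rfl | rfl | rfl
  · exact absurd rfl n1
  · rcases hq3 with rfl | rfl | rfl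
    · exact pa e1 e3.symm
    · exact pb e1 e3.symm
    · exact absurd rfl n3
  · rcases hq2 with rfl | rfl | rfl
    · exact pa e2.symm e1
    · exact absurd rfl n2
    · exact pc e1 e2

open Classical in
/-- Two members that use edges inside `S` at the same centre can be exchanged for one that uses
none and one that uses both edges. -/
lemma IsPacking.exists_swap [Fintype ι] (hP : IsPacking G S D F) {i j : ι} (hij : i ≠ j) {y : V}
    (hi : SpansWithEdge G S (D i) (F i) y) (hj : SpansWithEdge G S (D j) (F j) y)
    (hni : ¬ Spans G S (D i)) (hnj : ¬ Spans G S (D j)) :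
    ∃ (D' : ι → Set V) (F' : ι → SimpleGraph V), IsPacking G S D' F' ∧
      (Finset.univ.filter fun l => Spans G S (D l)).card <
        (Finset.univ.filter fun l => Spans G S (D' l)).card := by
  obtain ⟨x, z, hS, hxy, hyz, hxz, hr, he⟩ := hi
  obtain ⟨x', z', hS', hxy', hyz', hxz', hr', he'⟩ := hj
  have hxx : x' ≠ x := by
    rintro rfl
    exact hij (hP.edgeDisj _ _ _ _ he he')
  have hx' : x' ∈ S := by simp [hS']
  have hz' : z' ∈ S := by simp [hS']
  have hxz : x' = z := by
    rw [hS] at hx'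
    rcases hx' with h | h | h
    exacts [absurd h hxx, absurd h hxy', h]
  have hzx : z' = x := by
    rw [hS] at hz'
    rcases hz' with h | h | h
    exacts [h, absurd h.symm hyz', absurd (hxz.trans h.symm) hxz']
  subst hxz hzx
  -- The two inner edges at `y` go to different terminals, so `D i` and `D j` join `y` to different
  -- terminals as well.
  have hspan : Spans G S (D i ∪ D j) := by
    refine reachable_all_of_base y ?_
    have m1 := hr.mono (touchGraph_mono G S (D' := D i ∪ D j) Set.subset_union_left)
    have m2 := hr'.mono (touchGraph_mono G S (D' := D i ∪ D j) Set.subset_union_right)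
    intro v hv
    rw [hS] at hv
    rcases hv with rfl | rfl | rfl
    exacts [m2.symm, Reachable.refl _, m1.symm]
  have yS : y ∈ S := by simp [hS]
  -- Index `i` receives all outer vertices and no inner edge; index `j` keeps only the two inner
  -- edges, which form a path centred at `y`.
  let D' : ι → Set V := Function.update (Function.update D i (D i ∪ D j)) j ∅
  let F' : ι → SimpleGraph V := Function.update (Function.update F i ⊥) j (F i ⊔ F j)
  have hDi : D' i = D i ∪ D j := by simp [D', Function.update_of_ne hij]
  have hDj : D' j = ∅ := by simp [D']
  have hDl : ∀ l, l ≠ i → l ≠ j → D' l = D l := fun l h h' => by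
    simp [D', Function.update_of_ne h, Function.update_of_ne h']
  have hFi : F' i = ⊥ := by simp [F', Function.update_of_ne hij]
  have hFj : F' j = F i ⊔ F j := by simp [F']
  have hFl : ∀ l, l ≠ i → l ≠ j → F' l = F l := fun l h h' => by
    simp [F', Function.update_of_ne h, Function.update_of_ne h']
  have hDmem : ∀ l v, v ∈ D' l → ∃ m, v ∈ D m ∧ ((l = i ∧ (m = i ∨ m = j)) ∨
      (l ≠ i ∧ l ≠ j ∧ m = l)) := by
    intro l v hv
    by_cases h1 : l = i
    · subst h1
      rw [hDi] at hv
      exact hv.elim (fun h => ⟨_, h, by tauto⟩) (fun h => ⟨_, h, by tauto⟩)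
    by_cases h2 : l = j
    · subst h2
      rw [hDj] at hv
      exact hv.elim
    · rw [hDl _ h1 h2] at hv
      exact ⟨l, hv, by tauto⟩
  have hFmem : ∀ l u v, (F' l).Adj u v → ∃ m, (F m).Adj u v ∧ ((l = j ∧ (m = i ∨ m = j)) ∨
      (l ≠ i ∧ l ≠ j ∧ m = l)) := by
    intro l u v hv
    by_cases h1 : l = i
    · subst h1
      rw [hFi] at hv
      exact hv.elim
    by_cases h2 : l = j
    · subst h2
      rw [hFj] at hv
      exact hv.elim (fun h => ⟨_, h, by tauto⟩) (fun h => ⟨_, h, by tauto⟩)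
    · rw [hFl _ h1 h2] at hv
      exact ⟨l, hv, by tauto⟩
  refine ⟨D', F', ⟨?_, ?_, ?_, ?_, ?_⟩, ?_⟩
  · intro l v hv
    obtain ⟨m, hm, -⟩ := hDmem l v hv
    exact hP.notMem _ _ hm
  · intro l l' v hv hv'
    obtain ⟨m, hm, h⟩ := hDmem l v hv
    obtain ⟨m', hm', h'⟩ := hDmem l' v hv'
    have := hP.disj _ _ _ hm hm'
    subst this
    rcases h with ⟨rfl, h⟩ | ⟨h1, h2, rfl⟩ <;> rcases h' with ⟨rfl, h'⟩ | ⟨h1', h2', rfl⟩ <;> tauto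
  · intro l u v hv
    obtain ⟨m, hm, -⟩ := hFmem l u v hv
    exact hP.le _ _ _ hm
  · intro l l' u v hv hv'
    obtain ⟨m, hm, h⟩ := hFmem l u v hv
    obtain ⟨m', hm', h'⟩ := hFmem l' u v hv'
    have := hP.edgeDisj _ _ _ _ hm hm'
    subst this
    rcases h with ⟨rfl, h⟩ | ⟨h1, h2, rfl⟩ <;> rcases h' with ⟨rfl, h'⟩ | ⟨h1', h2', rfl⟩ <;> tauto
  · intro l
    by_cases h1 : l = i
    · subst h1
      rw [hDi, hFi, sup_bot_eq]
      refine reachable_all_of_base y ?_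
      rintro v (hv | hv | hv)
      · exact hspan _ hv _ yS
      · obtain ⟨t, ht, h⟩ := hP.exists_touch_reachable yS l hv
        exact (h.mono (touchGraph_mono G S Set.subset_union_left)).trans (hspan t ht y yS)
      · obtain ⟨t, ht, h⟩ := hP.exists_touch_reachable yS j hv
        exact (h.mono (touchGraph_mono G S Set.subset_union_right)).trans (hspan t ht y yS)
    by_cases h2 : l = j
    · subst h2
      rw [hDj, hFj, Set.union_empty]
      refine reachable_all_of_base y ?_
      intro v hv
      have a1 : (touchGraph G S ∅ ⊔ (F i ⊔ F l)).Adj z' y := Or.inr (Or.inl he)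
      have a2 : (touchGraph G S ∅ ⊔ (F i ⊔ F l)).Adj x' y := Or.inr (Or.inr he')
      rw [hS] at hv
      rcases hv with rfl | rfl | rfl
      exacts [a1.reachable, Reachable.refl _, a2.reachable]
    · rw [hDl _ h1 h2, hFl _ h1 h2]
      exact hP.conn l
  · apply Finset.card_lt_card
    rw [Finset.ssubset_iff_of_subset]
    · exact ⟨i, by simpa [hDi] using hspan, by simpa using hni⟩
    · intro l hl
      simp only [Finset.mem_filter, Finset.mem_univ, true_and] at hl ⊢
      have h1 : l ≠ i := by rintro rfl; exact hni hl
      have h2 : l ≠ j := by rintro rfl; exact hnj hl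
      rwa [hDl _ h1 h2]

/-- The subset `L` of `S` is a set of layers which, together with `D`, replaces the edges of
`F` inside `S`. -/
def LayersSuffice (G : SimpleGraph V) (S D : Set V) (L : Set V) : Prop :=
  Spans G S D ∨
  (∃ x y z, S = {x, y, z} ∧ y ≠ z ∧ (touchGraph G S D).Reachable y z ∧ G.Adj y x ∧ y ∈ L) ∨
  (∃ x y z, S = {x, y, z} ∧ G.Adj y x ∧ G.Adj y z ∧ y ∈ L ∧ (x ∈ L ∨ z ∈ L))

open Classical in
/-- A packing of a three-element set can be chosen so that pairwise disjoint sets of layers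
replace the edges inside `S`. -/
theorem IsPacking.exists_layers [Finite V] [Fintype ι] (hP₀ : IsPacking G S D F) {a b c : V}
    (hab : a ≠ b) (hbc : b ≠ c) (hac : a ≠ c) (hS : S = {a, b, c}) :
    ∃ (D' : ι → Set V) (F' : ι → SimpleGraph V) (L : ι → Set V), IsPacking G S D' F' ∧
      (∀ i, L i ⊆ S) ∧ (∀ i j x, x ∈ L i → x ∈ L j → i = j) ∧
      ∀ i, LayersSuffice G S (D' i) (L i) := by
  -- By maximality no swap is possible, so members using one inner edge have distinct centres, and a
  -- centre can serve as the layer set.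
  obtain ⟨⟨D, F⟩, hP, hmax⟩ := Set.exists_max_image
    {P : (ι → Set V) × (ι → SimpleGraph V) | IsPacking G S P.1 P.2}
    (fun P => (Finset.univ.filter fun l => Spans G S (P.1 l)).card) (Set.toFinite _) ⟨(D, F), hP₀⟩
  change IsPacking G S D F at hP
  have hconf : ∀ i j y, ¬ Spans G S (D i) → ¬ Spans G S (D j) →
      SpansWithEdge G S (D i) (F i) y → SpansWithEdge G S (D j) (F j) y → i = j := by
    intro i j y hi hj hi' hj'
    by_contra hij
    obtain ⟨D', F', hP', hlt⟩ := hP.exists_swap hij hi' hj' hi hj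
    exact absurd (hmax (D', F') hP') (not_le.2 hlt)
  have hcen : ∀ i, ∃ y, ¬ Spans G S (D i) → SpansWithEdge G S (D i) (F i) y ∨
      (SpansWithPath S (F i) y ∧ ¬ ∃ y, SpansWithEdge G S (D i) (F i) y) := by
    intro i
    rcases hP.spans_cases hab hbc hac hS i with h | h | ⟨y, h⟩
    · exact ⟨a, fun h' => absurd h h'⟩
    · obtain ⟨y, h⟩ := h
      exact ⟨y, fun _ => Or.inl h⟩
    · by_cases h' : ∃ y, SpansWithEdge G S (D i) (F i) y
      · obtain ⟨y, h'⟩ := h'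
        exact ⟨y, fun _ => Or.inl h'⟩
      · exact ⟨y, fun _ => Or.inr ⟨h, h'⟩⟩
  choose cen hcen using hcen
  by_cases hC : ∃ i₀, ¬ Spans G S (D i₀) ∧ ¬ ∃ y, SpansWithEdge G S (D i₀) (F i₀) y
  · obtain ⟨i₀, hn, hne⟩ := hC
    obtain ⟨x, z, hSx, hxy, hyz, hxz, e1, e2⟩ := ((hcen i₀ hn).resolve_left
      (fun h => hne ⟨_, h⟩)).1
    -- The member `i₀` owns two of the three possible inner edges, leaving only `xz` to the others.
    have hother : ∀ j, j ≠ i₀ → ∀ p q, (F j).Adj p q →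
        (p = x ∧ q = z) ∨ (p = z ∧ q = x) := by
      intro j hj p q hpq
      have hpS := (hP.le _ _ _ hpq).2.1
      have hqS := (hP.le _ _ _ hpq).2.2
      have hnpq := hpq.ne
      have f1 : ¬ (F j).Adj x (cen i₀) := fun h => hj (hP.edgeDisj _ _ _ _ h e1)
      have f2 : ¬ (F j).Adj (cen i₀) z := fun h => hj (hP.edgeDisj _ _ _ _ h e2)
      have f3 : ¬ (F j).Adj (cen i₀) x := fun h => f1 h.symm
      have f4 : ¬ (F j).Adj z (cen i₀) := fun h => f2 h.symm
      rw [hSx] at hpS hqS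
      rcases hpS with rfl | rfl | rfl <;> rcases hqS with rfl | rfl | rfl <;> tauto
    have hB : ∀ j, j ≠ i₀ → ¬ Spans G S (D j) → SpansWithEdge G S (D j) (F j) (cen j) := by
      intro j hj hnj
      refine (hcen j hnj).resolve_right ?_
      rintro ⟨⟨p, r, -, h1, h2, h3, f1, f2⟩, -⟩
      rcases hother j hj _ _ f1 with ⟨u1, u2⟩ | ⟨u1, u2⟩ <;>
        rcases hother j hj _ _ f2 with ⟨u3, u4⟩ | ⟨u3, u4⟩ <;>
        simp_all
    have hBadj : ∀ j, j ≠ i₀ → ¬ Spans G S (D j) → (F j).Adj x z ∧ (cen j = x ∨ cen j = z) := by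
      intro j hj hnj
      obtain ⟨p, r, -, -, -, -, -, f⟩ := hB j hj hnj
      rcases hother j hj _ _ f with ⟨h1, h2⟩ | ⟨h1, h2⟩
      · rw [h1, h2] at f
        exact ⟨f, Or.inr h2⟩
      · rw [h1, h2] at f
        exact ⟨f.symm, Or.inl h2⟩
    -- At most one other member uses `xz`, and its centre is `x` or `z`; the remaining one of these
    -- two is the second layer that `i₀` needs.
    obtain ⟨w, hw, hwc⟩ : ∃ w, (w = x ∨ w = z) ∧
        ∀ j, j ≠ i₀ → ¬ Spans G S (D j) → cen j ≠ w := by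
      by_cases h : ∃ j, j ≠ i₀ ∧ ¬ Spans G S (D j) ∧ cen j = x
      · obtain ⟨j, hj, hnj, hjx⟩ := h
        refine ⟨z, Or.inr rfl, fun l hl hnl hlz => ?_⟩
        have := hP.edgeDisj _ _ _ _ (hBadj j hj hnj).1 (hBadj l hl hnl).1
        subst this
        exact hxz (hjx.symm.trans hlz)
      · push Not at h
        exact ⟨x, Or.inl rfl, h⟩
    have hcS : ∀ j, j ≠ i₀ → ¬ Spans G S (D j) → cen j ∈ S := by
      intro j hj hnj
      rcases (hBadj j hj hnj).2 with h | h <;> simp [hSx, h]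
    have hcy : ∀ j, j ≠ i₀ → ¬ Spans G S (D j) → cen j ≠ cen i₀ := by
      intro j hj hnj h
      rcases (hBadj j hj hnj).2 with h' | h'
      · exact hxy (h'.symm.trans h)
      · exact hyz (h.symm.trans h')
    let L : ι → Set V := fun i => {v | ¬ Spans G S (D i) ∧ (v = cen i ∨ (i = i₀ ∧ v = w))}
    refine ⟨D, F, L, hP, ?_, ?_, ?_⟩
    · rintro i v ⟨hni, h⟩
      by_cases hi : i = i₀
      · subst hi
        rcases h with rfl | ⟨-, rfl⟩
        · simp [hSx]
        · rcases hw with rfl | rfl <;> simp [hSx]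
      · rcases h with rfl | ⟨h, -⟩
        exacts [hcS i hi hni, absurd h hi]
    · rintro i j v ⟨hni, hi⟩ ⟨hnj, hj⟩
      by_cases hi0 : i = i₀ <;> by_cases hj0 : j = i₀
      · rw [hi0, hj0]
      · subst hi0
        have h1 := hcy j hj0 hnj
        have h2 := hwc j hj0 hnj
        have hjv : v = cen j := by tauto
        subst hjv
        tauto
      · subst hj0
        have h1 := hcy i hi0 hni
        have h2 := hwc i hi0 hni
        have hiv : v = cen i := by tauto
        subst hiv
        tauto
      · have hiv : v = cen i := by tauto
        have hjv : v = cen j := by tauto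
        have h1 := hB i hi0 hni
        have h2 := hB j hj0 hnj
        rw [← hiv] at h1
        rw [← hjv] at h2
        exact hconf i j v hni hnj h1 h2
    · intro i
      by_cases hi : Spans G S (D i)
      · exact Or.inl hi
      right
      by_cases hi0 : i = i₀
      · subst hi0
        refine Or.inr ⟨x, cen i, z, hSx, (hP.le _ _ _ e1).1.symm, (hP.le _ _ _ e2).1,
          ⟨hi, Or.inl rfl⟩, ?_⟩
        exact hw.imp (fun h => ⟨hi, Or.inr ⟨rfl, h.symm⟩⟩) (fun h => ⟨hi, Or.inr ⟨rfl, h.symm⟩⟩)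
      · obtain ⟨p, r, h1, h2, h3, h4, h5, h6⟩ := hB i hi0 hi
        exact Or.inl ⟨p, cen i, r, h1, h3, h5, (hP.le _ _ _ h6).1.symm, hi, Or.inl rfl⟩
  · push Not at hC
    have hB : ∀ j, ¬ Spans G S (D j) → SpansWithEdge G S (D j) (F j) (cen j) := fun j hj =>
      (hcen j hj).resolve_right fun h => h.2 (hC j hj)
    let L : ι → Set V := fun i => {v | ¬ Spans G S (D i) ∧ v = cen i}
    refine ⟨D, F, L, hP, ?_, ?_, ?_⟩
    · rintro i v ⟨hni, rfl⟩
      obtain ⟨p, r, h1, -⟩ := hB i hni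
      simp [h1]
    · rintro i j v ⟨hni, hi⟩ ⟨hnj, hj⟩
      have h1 := hB i hni
      have h2 := hB j hnj
      rw [← hi] at h1
      rw [← hj] at h2
      exact hconf i j v hni hnj h1 h2
    · intro i
      by_cases hi : Spans G S (D i)
      · exact Or.inl hi
      obtain ⟨p, r, h1, h2, h3, h4, h5, h6⟩ := hB i hi
      exact Or.inr (Or.inl ⟨p, cen i, r, h1, h3, h5, (hP.le _ _ _ h6).1.symm, hi, rfl⟩)

end Layers

/-! ### Terminals in three different layers -/

/-- A map between vertex sets that preserves the relevant edges preserves reachability by edges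
meeting a set. -/
lemma touchGraph_reachable_map {X Y : Type*} {G : SimpleGraph X} {Γ : SimpleGraph Y} {S D : Set X}
    {S' D' : Set Y} (φ : X → Y) (hadj : ∀ x y, G.Adj x y → Γ.Adj (φ x) (φ y))
    (hS : ∀ x ∈ S, φ x ∈ S') (hD : ∀ x ∈ D, φ x ∈ D') {x y : X}
    (h : (touchGraph G S D).Reachable x y) : (touchGraph Γ S' D').Reachable (φ x) (φ y) := by
  refine h.map (G' := touchGraph Γ S' D') ⟨φ, ?_⟩
  intro a b hab
  exact ⟨hadj _ _ hab.1, hab.2.1.imp (hS _) (hD _), hab.2.2.1.imp (hS _) (hD _),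
    hab.2.2.2.imp (hD _) (hD _)⟩

/-- Supplies a neighbour `q` of `y` in `D`, through which a spare copy of `y` can be tied to `y`
itself. -/
lemma exists_adj_of_touchGraph_reachable {X : Type*} {G : SimpleGraph X} {S D : Set X} {y z : X}
    (h : (touchGraph G S D).Reachable y z) (hyz : y ≠ z) (hy : y ∉ D) :
    ∃ q ∈ D, G.Adj y q ∧ (touchGraph G S D).Reachable y q := by
  obtain ⟨p, q, hpq, hp, hq⟩ := exists_boundary_adj h {y} rfl (fun h => hyz h.symm)
  rw [Set.mem_singleton_iff] at hp
  subst hp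
  exact ⟨q, hpq.2.2.2.resolve_left hy, hpq.1, hpq.reachable⟩

/-- Three vertices in distinct layers. -/
theorem mul_card_le_localConn_lexProd_of_section [Fintype V] [Fintype W] (G : SimpleGraph V)
    (H : SimpleGraph W) (σ : V → W) {a b c : V} (hab : a ≠ b) (hbc : b ≠ c) (hac : a ≠ c) {k : ℕ}
    (hk : k ≤ localConn G {a, b, c}) :
    k * Fintype.card W ≤ localConn (lexProd G H) ((fun v => (v, σ v)) '' {a, b, c}) := by
  classical
  obtain ⟨D₀, F₀, hP₀⟩ := exists_packing_of_le_localConn hk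
  obtain ⟨D, F, L, hP, hLS, hLd, hL⟩ := hP₀.exists_layers hab hbc hac rfl
  clear hP₀ hk D₀ F₀
  have haS : a ∈ ({a, b, c} : Set V) := by simp
  have hbS : b ∈ ({a, b, c} : Set V) := by simp
  generalize ({a, b, c} : Set V) = S at *
  let h₀ : W := σ a
  -- Relabelling each layer puts all terminals at the height `h₀`. Edges between layers are
  -- unaffected.
  let τ : V → Equiv.Perm W := fun v => Equiv.swap h₀ (σ v)
  have hτ : ∀ v, τ v h₀ = σ v := fun v => Equiv.swap_apply_left _ _
  set S' : Set (V × W) := (fun v => (v, σ v)) '' S with hS'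
  have memS' : ∀ v w, (v, τ v w) ∈ S' ↔ v ∈ S ∧ w = h₀ := by
    intro v w
    constructor
    · rintro ⟨u, hu, huv⟩
      simp only [Prod.mk.injEq] at huv
      obtain ⟨rfl, h⟩ := huv
      rw [← hτ u] at h
      exact ⟨hu, ((τ u).injective h).symm⟩
    · rintro ⟨hv, rfl⟩
      exact ⟨v, hv, by rw [hτ]⟩
  have adjτ : ∀ {u v : V}, G.Adj u v → ∀ w w', (lexProd G H).Adj (u, τ u w) (v, τ v w') :=
    fun h w w' => Or.inl h
  -- The copy at `h₀` may keep the original inner edges, so only the other heights receive spare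
  -- vertices above `L`.
  let D' : Fin k × W → Set (V × W) := fun i =>
    {p | (p.1 ∈ D i.1 ∨ (i.2 ≠ h₀ ∧ p.1 ∈ L i.1)) ∧ p.2 = τ p.1 i.2}
  let F' : Fin k × W → SimpleGraph (V × W) := fun i =>
    { Adj := fun p q => i.2 = h₀ ∧ p ∈ S' ∧ q ∈ S' ∧ (F i.1).Adj p.1 q.1
      symm := ⟨fun p q h => ⟨h.1, h.2.2.1, h.2.1, h.2.2.2.symm⟩⟩
      loopless := ⟨fun p h => (F i.1).loopless.irrefl _ h.2.2.2⟩ }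
  have hP' : IsPacking (lexProd G H) S' D' F' := by
    refine ⟨?_, ?_, ?_, ?_, ?_⟩
    · rintro ⟨i, h⟩ ⟨v, w⟩ ⟨h1, h2⟩
      simp only at h1 h2
      subst h2
      rw [memS']
      rintro ⟨h3, h4⟩
      rcases h1 with h1 | h1
      · exact hP.notMem _ _ h1 h3
      · exact h1.1 h4
    · rintro ⟨i, h⟩ ⟨j, h'⟩ ⟨v, w⟩ ⟨h1, h2⟩ ⟨h3, h4⟩
      simp only at h1 h2 h3 h4
      have hhh : h = h' := (τ v).injective (h2.symm.trans h4)
      subst hhh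
      have : i = j := by
        rcases h1 with h1 | h1 <;> rcases h3 with h3 | h3
        · exact hP.disj _ _ _ h1 h3
        · exact absurd (hLS _ h3.2) (hP.notMem _ _ h1)
        · exact absurd (hLS _ h1.2) (hP.notMem _ _ h3)
        · exact hLd _ _ _ h1.2 h3.2
      rw [this]
    · rintro i p q ⟨h1, h2, h3, h4⟩
      exact ⟨Or.inl (hP.le _ _ _ h4).1, h2, h3⟩
    · rintro ⟨i, h⟩ ⟨j, h'⟩ p q ⟨h1, h2, h3, h4⟩ ⟨h1', h2', h3', h4'⟩
      exact Prod.ext (hP.edgeDisj _ _ _ _ h4 h4') (h1.trans h1'.symm)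
    · rintro ⟨i, h⟩
      by_cases hh : h = h₀
      · subst hh
        have memD : ∀ v, v ∈ S ∪ D i → (v, τ v h₀) ∈ S' ∪ D' (i, h₀) := fun v hv =>
          hv.imp (fun hv => (memS' _ _).2 ⟨hv, rfl⟩) (fun hv => ⟨Or.inl hv, rfl⟩)
        have hmap : ∀ u v, (touchGraph G S (D i) ⊔ F i).Reachable u v →
            (touchGraph (lexProd G H) S' (D' (i, h₀)) ⊔ F' (i, h₀)).Reachable
              (u, τ u h₀) (v, τ v h₀) := by
          intro u v huv
          refine huv.map (G' := _ ⊔ _) ⟨fun v => (v, τ v h₀), ?_⟩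
          rintro x y (hxy | hxy)
          · exact Or.inl ⟨Or.inl hxy.1, memD _ hxy.2.1, memD _ hxy.2.2.1,
              hxy.2.2.2.imp (fun hv => ⟨Or.inl hv, rfl⟩) (fun hv => ⟨Or.inl hv, rfl⟩)⟩
          · exact Or.inr ⟨rfl, (memS' _ _).2 ⟨(hP.le _ _ _ hxy).2.1, rfl⟩,
              (memS' _ _).2 ⟨(hP.le _ _ _ hxy).2.2, rfl⟩, hxy⟩
        have hform : ∀ p ∈ S' ∪ D' (i, h₀), p.1 ∈ S ∪ D i ∧ p = (p.1, τ p.1 h₀) := by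
          rintro p (⟨v, hv, rfl⟩ | ⟨h1, h2⟩)
          · exact ⟨Or.inl hv, by rw [hτ]⟩
          · exact ⟨Or.inr (h1.resolve_right fun h => h.1 rfl), Prod.ext rfl h2⟩
        intro p hp q hq
        obtain ⟨h1, h2⟩ := hform p hp
        obtain ⟨h3, h4⟩ := hform q hq
        rw [h2, h4]
        exact hmap _ _ (hP.conn i _ h1 _ h3)
      · have hF : F' (i, h) = ⊥ := by
          ext p q
          exact ⟨fun hpq => absurd hpq.1 hh, fun hpq => hpq.elim⟩
        rw [hF, sup_bot_eq]
        set K := touchGraph (lexProd G H) S' (D' (i, h)) with hK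
        -- Terminals stay at height `h₀` while the rest of the tree moves to `h`.
        let φ : V → V × W := fun v => (v, τ v (if v ∈ S then h₀ else h))
        have φS : ∀ v ∈ S, φ v = (v, τ v h₀) := fun v hv => by simp [φ, hv]
        have φD : ∀ v ∈ D i, φ v = (v, τ v h) := fun v hv => by simp [φ, hP.notMem _ _ hv]
        have φS' : ∀ v ∈ S, φ v ∈ S' := fun v hv => by
          rw [φS v hv]; exact (memS' _ _).2 ⟨hv, rfl⟩
        have φD' : ∀ v ∈ D i, φ v ∈ D' (i, h) := fun v hv => by
          rw [φD v hv]; exact ⟨Or.inl hv, rfl⟩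
        have hlift : ∀ {u v}, (touchGraph G S (D i)).Reachable u v → K.Reachable (φ u) (φ v) :=
          fun huv => touchGraph_reachable_map φ (fun _ _ h => Or.inl h) φS' φD' huv
        have layerD' : ∀ y ∈ L i, (y, τ y h) ∈ D' (i, h) := fun y hy => ⟨Or.inr ⟨hh, hy⟩, rfl⟩
        have layerAdj : ∀ y ∈ L i, ∀ v, (v ∈ S ∪ D i) → G.Adj y v →
            K.Adj (y, τ y h) (φ v) := fun y hy v hv hyv =>
          ⟨Or.inl hyv, Or.inr (layerD' y hy), hv.imp (φS' v) (φD' v), Or.inl (layerD' y hy)⟩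
        obtain ⟨hSp, hLay⟩ : (∀ s ∈ S, ∀ t ∈ S, K.Reachable (φ s) (φ t)) ∧
            (∀ y ∈ L i, ∃ v ∈ S ∪ D i, G.Adj y v) := by
          refine ⟨?_, ?_⟩
          · rcases hL i with hL | ⟨x, y, z, hxyz, hyz, hr, hyx, hy⟩ |
              ⟨x, y, z, hxyz, hyx, hyz, hy, hxz⟩
            · exact fun s hs t ht => hlift (hL s hs t ht)
            · have hyS := hLS i hy
              obtain ⟨q, hq, hyq, hrq⟩ := exists_adj_of_touchGraph_reachable hr hyz
                (fun hyD => hP.notMem _ _ hyD hyS)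
              -- The inner edge `yx` is replaced by a detour from `y` to `q`, then to the spare copy
              -- of `y`, then to `x`.
              have a1 : K.Reachable (φ y) (φ x) := (hlift hrq).trans
                ((layerAdj y hy q (Or.inr hq) hyq).symm.reachable.trans
                  (layerAdj y hy x (Or.inl (by simp [hxyz])) hyx).reachable)
              have := reachable_all_of_base (K := K) (A := φ '' S) (φ y) (by
                rintro - ⟨v, hv, rfl⟩
                rw [hxyz] at hv
                rcases hv with rfl | rfl | rfl
                exacts [a1.symm, Reachable.refl _, (hlift hr).symm])
              exact fun s hs t ht => this _ ⟨s, hs, rfl⟩ _ ⟨t, ht, rfl⟩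
            · have hx := layerAdj y hy x (Or.inl (by simp [hxyz])) hyx
              have hz := layerAdj y hy z (Or.inl (by simp [hxyz])) hyz
              have hyS := hLS i hy
              obtain ⟨w, hw, hyw⟩ : ∃ w ∈ L i, G.Adj y w := by
                rcases hxz with h | h
                exacts [⟨x, h, hyx⟩, ⟨z, h, hyz⟩]
              -- The spare copy of `y` sees `x` and `z` but not `y`; the spare copy of `w` joins it
              -- to `y`.
              have a1 : K.Adj (w, τ w h) (φ y) := layerAdj w hw y (Or.inl hyS) hyw.symm
              have a2 : K.Adj (y, τ y h) (w, τ w h) :=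
                ⟨Or.inl hyw, Or.inr (layerD' y hy), Or.inr (layerD' w hw), Or.inl (layerD' y hy)⟩
              have := reachable_all_of_base (K := K) (A := φ '' S) (y, τ y h) (by
                rintro - ⟨v, hv, rfl⟩
                rw [hxyz] at hv
                rcases hv with rfl | rfl | rfl
                exacts [hx.symm.reachable, a1.symm.reachable.trans a2.symm.reachable,
                  hz.symm.reachable])
              exact fun s hs t ht => this _ ⟨s, hs, rfl⟩ _ ⟨t, ht, rfl⟩
          · intro y hy
            obtain ⟨t, ht, hty⟩ : ∃ t ∈ S, t ≠ y := by
              by_cases h : a = y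
              · exact ⟨b, hbS, fun h' => hab (h.trans h'.symm)⟩
              · exact ⟨a, haS, h⟩
            obtain ⟨p, q, hpq, hp, hq⟩ := exists_boundary_adj
              (hP.conn i y (Or.inl (hLS i hy)) t (Or.inl ht)) {y} rfl hty
            rw [Set.mem_singleton_iff] at hp
            subst hp
            exact ⟨q, (hP.adj_mem hpq).2.2, (hP.adj_mem hpq).1⟩
        have hD : ∀ v ∈ S ∪ D i, ∃ s ∈ S, K.Reachable (φ v) (φ s) := by
          rintro v (hv | hv)
          · exact ⟨v, hv, Reachable.refl _⟩
          · obtain ⟨t, ht, h⟩ := hP.exists_touch_reachable haS i hv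
            exact ⟨t, ht, hlift h⟩
        have hD2 : ∀ v ∈ S ∪ D i, K.Reachable (φ v) (φ a) := by
          intro v hv
          obtain ⟨s, hs, h⟩ := hD v hv
          exact h.trans (hSp s hs a haS)
        refine reachable_all_of_base (φ a) ?_
        rintro p (⟨v, hv, rfl⟩ | ⟨h1, h2⟩)
        · have := hD2 v (Or.inl hv)
          rwa [φS v hv, hτ] at this
        · obtain ⟨v, w⟩ := p
          simp only at h1 h2
          subst h2
          rcases h1 with h1 | h1
          · have := hD2 v (Or.inr h1)
            rwa [φD v h1] at this
          · obtain ⟨u, hu, hvu⟩ := hLay v h1.2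
            exact (layerAdj v h1.2 u hu hvu).reachable.trans (hD2 u hu)
  have := hP'.card_le_localConn ⟨(a, σ a), ⟨a, haS, rfl⟩, (b, σ b), ⟨b, hbS, rfl⟩,
    fun h => hab (congrArg Prod.fst h)⟩
  simpa using this

/-! ### Menger's theorem from Hall's theorem -/

open Classical in
/-- A form of Menger's theorem, obtained from Hall's theorem: if every set separating `u₁` from
`u₂`, after removal of a possible edge `u₁u₂`, has at least `j` elements, there are `j` disjoint
vertex sets avoiding `u₁` and `u₂`, each of which connects them. -/
theorem exists_packing_pair [Fintype V] (G : SimpleGraph V) {u₁ u₂ : V} (j : ℕ)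
    (hcut : ∀ Y : Finset V, u₁ ∉ Y → u₂ ∉ Y → (∀ y ∈ Y, ¬ G.Adj y u₂) →
      j ≤ (Finset.univ.filter fun v => v ≠ u₁ ∧ v ≠ u₂ ∧ v ∉ Y ∧
        (G.Adj u₁ v ∨ ∃ y ∈ Y, G.Adj y v)).card) :
    ∃ P : Fin j → Set V, IsPacking G {u₁, u₂} P (fun _ => ⊥) := by
  -- The left copies of `Fin j` are sources at `u₁`, the right ones sinks at `u₂`. A vertex is
  -- matched to itself (idle), to its successor, or to a sink, so a matching of the left side
  -- encodes `j` disjoint routes.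
  let R : Fin j ⊕ V → V ⊕ Fin j → Prop := fun x y => match x, y with
    | .inl _, .inl v => v ≠ u₁ ∧ v ≠ u₂ ∧ G.Adj u₁ v
    | .inl _, .inr _ => False
    | .inr v, .inl w => w = v ∨ (v ≠ u₁ ∧ v ≠ u₂ ∧ w ≠ u₁ ∧ w ≠ u₂ ∧ G.Adj v w)
    | .inr v, .inr _ => v ≠ u₁ ∧ v ≠ u₂ ∧ G.Adj v u₂
  obtain ⟨f, hfinj, hf⟩ : ∃ f : Fin j ⊕ V → V ⊕ Fin j, Function.Injective f ∧
      ∀ x, R x (f x) := by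
    have := (Finset.all_card_le_biUnion_card_iff_exists_injective
      (fun x => Finset.univ.filter fun y => R x y)).1 ?_
    · obtain ⟨f, h1, h2⟩ := this
      exact ⟨f, h1, fun x => by simpa using h2 x⟩
    intro Z
    have hZ := Finset.card_toLeft_add_card_toRight (u := Z)
    have hmem : ∀ x ∈ Z, ∀ y, R x y → y ∈ Z.biUnion fun x => Finset.univ.filter fun y => R x y :=
      fun x hx y hxy => Finset.mem_biUnion.2 ⟨x, hx, by simpa using hxy⟩
    generalize (Z.biUnion fun x => Finset.univ.filter fun y => R x y) = N at hmem ⊢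
    have hN := Finset.card_toLeft_add_card_toRight (u := N)
    have hYN : Z.toRight ⊆ N.toLeft := by
      intro v hv
      rw [Finset.mem_toLeft]
      exact hmem _ (Finset.mem_toRight.1 hv) _ (Or.inl rfl)
    have hle := Finset.card_le_card hYN
    by_cases hsrc : Z.toLeft = ∅
    · rw [hsrc, Finset.card_empty] at hZ
      omega
    obtain ⟨i, hi⟩ := Finset.nonempty_iff_ne_empty.2 hsrc
    have hij : Z.toLeft.card ≤ j := by simpa using Finset.card_le_univ Z.toLeft
    -- Idling already gives `Z.toRight` as images. The missing `j` come from the sinks if some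
    -- vertex of `Z` sees them, and otherwise from `hcut`.
    by_cases hsink : ∃ y ∈ Z.toRight, y ≠ u₁ ∧ y ≠ u₂ ∧ G.Adj y u₂
    · obtain ⟨y, hy, hyu⟩ := hsink
      have : N.toRight = Finset.univ := by
        ext l
        simp only [Finset.mem_toRight, Finset.mem_univ, iff_true]
        exact hmem _ (Finset.mem_toRight.1 hy) _ hyu
      rw [this, Finset.card_univ, Fintype.card_fin] at hN
      omega
    · push Not at hsink
      have hc := hcut (Z.toRight.filter fun v => v ≠ u₁ ∧ v ≠ u₂) (by simp) (by simp)
        (fun y hy => by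
          rw [Finset.mem_filter] at hy
          exact hsink y hy.1 hy.2.1 hy.2.2)
      set C := Finset.univ.filter fun v => v ≠ u₁ ∧ v ≠ u₂ ∧
        v ∉ (Z.toRight.filter fun v => v ≠ u₁ ∧ v ≠ u₂) ∧
        (G.Adj u₁ v ∨ ∃ y ∈ (Z.toRight.filter fun v => v ≠ u₁ ∧ v ≠ u₂), G.Adj y v) with hCdef
      have hdis : Disjoint Z.toRight C := by
        rw [Finset.disjoint_left]
        intro v hv hvC
        simp only [hCdef, Finset.mem_filter, Finset.mem_univ, true_and] at hvC
        tauto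
      have hsub : Z.toRight ∪ C ⊆ N.toLeft := by
        refine Finset.union_subset hYN ?_
        intro v hvC
        simp only [hCdef, Finset.mem_filter, Finset.mem_univ, true_and] at hvC
        rw [Finset.mem_toLeft]
        obtain ⟨h1, h2, -, h3 | ⟨y, hy, h3⟩⟩ := hvC
        · exact hmem _ (Finset.mem_toLeft.1 hi) _ ⟨h1, h2, h3⟩
        · exact hmem _ (Finset.mem_toRight.1 hy.1) _ (Or.inr ⟨hy.2.1, hy.2.2, h1, h2, h3⟩)
      have := Finset.card_le_card hsub
      rw [Finset.card_union_of_disjoint hdis] at this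
      omega
  have hstart : ∀ i, ∃ v, f (.inl i) = .inl v ∧ v ≠ u₁ ∧ v ≠ u₂ ∧ G.Adj u₁ v := by
    intro i
    have := hf (.inl i)
    rcases hfi : f (.inl i) with v | l
    · rw [hfi] at this
      exact ⟨v, rfl, this⟩
    · rw [hfi] at this
      exact this.elim
  choose start hst hs1 hs2 hs3 using hstart
  let P : Fin j → Set V := fun i =>
    {v | Relation.ReflTransGen (fun v w => f (.inr v) = .inl w) (start i) v}
  have hstep : ∀ v w, f (.inr v) = .inl w →
      w = v ∨ (v ≠ u₁ ∧ v ≠ u₂ ∧ w ≠ u₁ ∧ w ≠ u₂ ∧ G.Adj v w) := by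
    intro v w hvw
    have := hf (.inr v)
    rwa [hvw] at this
  have hstart_ne : ∀ i w, f (.inr w) ≠ .inl (start i) := fun i w h => by
    have := hfinj (h.trans (hst i).symm)
    simp at this
  have hPu : ∀ i, ∀ v ∈ P i, v ≠ u₁ ∧ v ≠ u₂ := by
    intro i v hv
    induction hv with
    | refl => exact ⟨hs1 i, hs2 i⟩
    | tail _ h ih =>
      rcases hstep _ _ h with rfl | h
      exacts [ih, ⟨h.2.2.1, h.2.2.2.1⟩]
  have hreach : ∀ i, ∀ v ∈ P i, (touchGraph G {u₁, u₂} (P i)).Reachable v u₁ := by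
    intro i v hv
    induction hv with
    | refl =>
      have : (touchGraph G {u₁, u₂} (P i)).Adj (start i) u₁ :=
        ⟨(hs3 i).symm, Or.inr Relation.ReflTransGen.refl, Or.inl (by simp),
          Or.inl Relation.ReflTransGen.refl⟩
      exact this.reachable
    | @tail b c hb h ih =>
      rcases hstep _ _ h with rfl | h'
      · exact ih
      · have : (touchGraph G {u₁, u₂} (P i)).Adj c b :=
          ⟨h'.2.2.2.2.symm, Or.inr (hb.tail h), Or.inr hb, Or.inr hb⟩
        exact this.reachable.trans ih
  have hend : ∀ i, ∃ v ∈ P i, G.Adj v u₂ := by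
    intro i
    by_contra! hcon
    have hnext : ∀ v : P i, ∃ w : P i, f (.inr v.1) = .inl w.1 := by
      intro v
      have := hf (.inr v.1)
      rcases hfv : f (.inr v.1) with w | l
      · exact ⟨⟨w, Relation.ReflTransGen.tail v.2 hfv⟩, rfl⟩
      · rw [hfv] at this
        exact absurd this.2.2 (hcon _ v.2)
    -- An orbit that never meets a sink would be permuted by the injective `g`, making its start an
    -- image of a vertex, whereas it is already the image of a source.
    choose g hg using hnext
    have hginj : Function.Injective g := by
      intro v w hvw
      have h := hg v
      rw [hvw, ← hg w] at h
      exact Subtype.ext (Sum.inr.inj (hfinj h))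
    obtain ⟨w, hw⟩ := Finite.surjective_of_injective hginj ⟨start i, Relation.ReflTransGen.refl⟩
    have h := hg w
    rw [hw] at h
    exact hstart_ne i _ h
  refine ⟨P, ?_, ?_, ?_, ?_, ?_⟩
  · rintro i v hv (h | h)
    exacts [(hPu i v hv).1 h, (hPu i v hv).2 h]
  · intro i l v hi hl
    induction hi with
    | refl =>
      rcases Relation.ReflTransGen.cases_tail hl with h | ⟨w, -, h⟩
      · have := hst l
        rw [← h, ← hst i] at this
        exact (Sum.inl.inj (hfinj this)).symm
      · exact absurd h (hstart_ne i w)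
    | @tail b c hb h ih =>
      rcases Relation.ReflTransGen.cases_tail hl with h' | ⟨w, hw, h'⟩
      · exact absurd (h' ▸ h) (hstart_ne l b)
      · have := Sum.inr.inj (hfinj (h.trans h'.symm))
        exact ih (this ▸ hw)
  · exact fun i x y h => h.elim
  · exact fun i l x y h => h.elim
  · intro i
    rw [sup_bot_eq]
    refine reachable_all_of_base u₁ ?_
    rintro v ((rfl | rfl) | hv)
    · exact Reachable.refl _
    · obtain ⟨w, hw, hwv⟩ := hend i
      have : (touchGraph G {u₁, v} (P i)).Adj v w :=
        ⟨hwv.symm, Or.inl (by simp), Or.inr hw, Or.inr hw⟩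
      exact this.reachable.trans (hreach i w hw)
    · exact hreach i v hv

/-! ### Terminals sharing a layer -/

lemma exists_perm_pair {b b' a a' : W} (hb : b ≠ b') (ha : a ≠ a') :
    ∃ π : Equiv.Perm W, π b = a ∧ π b' = a' := by
  classical
  refine ⟨Equiv.swap (Equiv.swap b a b') a' * Equiv.swap b a, ?_, by simp⟩
  rw [Equiv.Perm.mul_apply, Equiv.swap_apply_left]
  refine Equiv.swap_apply_of_ne_of_ne ?_ ha
  intro h
  apply hb
  rw [Equiv.swap_apply_eq_iff.1 h.symm, Equiv.swap_apply_right]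

open Classical in
/-- Two vertices in one layer, and a third vertex in another one. -/
theorem mul_card_le_localConn_lexProd_of_pair [Fintype V] [Fintype W] (G : SimpleGraph V)
    {H : SimpleGraph W} (hH : H.Connected) {u₁ u₂ : V} (hu : u₁ ≠ u₂) {a a' b : W} (ha : a ≠ a')
    {j : ℕ} {P : Fin j → Set V} (hP : IsPacking G {u₁, u₂} P (fun _ => ⊥)) :
    (j + if G.Adj u₁ u₂ then 1 else 0) * Fintype.card W ≤
      localConn (lexProd G H) {(u₁, a), (u₁, a'), (u₂, b)} := by
  obtain ⟨b', hbb'⟩ : ∃ b', H.Adj b b' := by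
    obtain ⟨c, hc⟩ : ∃ c, c ≠ b := by
      by_cases h : a = b
      exacts [⟨a', fun h' => ha (h.trans h'.symm)⟩, ⟨a, h⟩]
    obtain ⟨p, q, hpq, hp, -⟩ := exists_boundary_adj (hH.preconnected b c) {b} rfl hc
    exact ⟨q, hp ▸ hpq⟩
  obtain ⟨π, hπ, hπ'⟩ := exists_perm_pair hbb'.ne ha
  set S' : Set (V × W) := {(u₁, a), (u₁, a'), (u₂, b)} with hS'
  have mem1 : ∀ h, (u₁, π h) ∈ S' ↔ h = b ∨ h = b' := by
    intro h
    have e1 : π h = a ↔ h = b := by rw [← hπ]; exact π.injective.eq_iff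
    have e2 : π h = a' ↔ h = b' := by rw [← hπ']; exact π.injective.eq_iff
    simp [hS', e1, e2, hu]
  have mem2 : ∀ h, (u₂, h) ∈ S' ↔ h = b := by
    intro h
    simp [hS', hu.symm]
  have memfst : ∀ p ∈ S', p.1 = u₁ ∨ p.1 = u₂ := by
    rintro p (rfl | rfl | rfl) <;> simp
  have hPu : ∀ i, ∀ v ∈ P i, v ≠ u₁ ∧ v ≠ u₂ := fun i v hv =>
    ⟨fun h => hP.notMem i v hv (by simp [h]), fun h => hP.notMem i v hv (by simp [h])⟩
  -- The right summand is empty unless `u₁u₂` is an edge. For it, `π` pairs the heights of the two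
  -- layers: `h = b` gives two inner edges, `h = b'` uses the `H`-edge `bb'`, and any other `h`
  -- reaches `(u₂, b)` through `(u₁, π h)`.
  let D' : (Fin j × W) ⊕ {_h : W // G.Adj u₁ u₂} → Set (V × W) := fun x => match x with
    | .inl (i, h) => {p | p.1 ∈ P i ∧ p.2 = h}
    | .inr h => {p | (p = (u₂, h.1) ∨ p = (u₁, π h.1)) ∧ p ∉ S'}
  let F' : (Fin j × W) ⊕ {_h : W // G.Adj u₁ u₂} → SimpleGraph (V × W) := fun x => match x with
    | .inl _ => ⊥
    | .inr h =>
      { Adj := fun p q => h.1 = b ∧ p ∈ S' ∧ q ∈ S' ∧ G.Adj p.1 q.1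
        symm := ⟨fun p q h => ⟨h.1, h.2.2.1, h.2.1, h.2.2.2.symm⟩⟩
        loopless := ⟨fun p h => G.loopless.irrefl _ h.2.2.2⟩ }
  have hmixed : ∀ i h h' p, p ∈ D' (.inl (i, h)) → p ∉ D' (.inr h') := by
    rintro i h h' p ⟨h1, h2⟩ ⟨rfl | rfl, h4⟩
    exacts [(hPu i _ h1).2 rfl, (hPu i _ h1).1 rfl]
  have hP' : IsPacking (lexProd G H) S' D' F' := by
    refine ⟨?_, ?_, ?_, ?_, ?_⟩
    · rintro (⟨i, h⟩ | h) p hp hpS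
      · rcases memfst p hpS with h' | h'
        exacts [(hPu i _ hp.1).1 h', (hPu i _ hp.1).2 h']
      · exact hp.2 hpS
    · rintro (⟨i, h⟩ | h) (⟨i', h'⟩ | h') p hp hp'
      · rw [hP.disj _ _ _ hp.1 hp'.1, ← hp.2, ← hp'.2]
      · exact absurd hp' (hmixed _ _ _ _ hp)
      · exact absurd hp (hmixed _ _ _ _ hp')
      · congr 1
        apply Subtype.ext
        obtain ⟨h1 | h1, -⟩ := hp <;> obtain ⟨h2 | h2, -⟩ := hp' <;>
          rw [h1] at h2 <;> simp only [Prod.mk.injEq] at h2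
        · exact h2.2
        · exact absurd h2.1.symm hu
        · exact absurd h2.1 hu
        · exact π.injective h2.2
    · rintro (⟨i, h⟩ | h) p q hpq
      · exact hpq.elim
      · exact ⟨Or.inl hpq.2.2.2, hpq.2.1, hpq.2.2.1⟩
    · rintro (⟨i, h⟩ | h) (⟨i', h'⟩ | h') p q hpq hpq'
      · exact hpq.elim
      · exact hpq.elim
      · exact hpq'.elim
      · congr 1
        exact Subtype.ext (hpq.1.trans hpq'.1.symm)
    · rintro (⟨i, h⟩ | ⟨h, hadj⟩)
      · have hF : F' (.inl (i, h)) = ⊥ := rfl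
        rw [hF, sup_bot_eq]
        have hmap : ∀ c, (u₁, c) ∈ S' → ∀ v ∈ ({u₁, u₂} : Set V) ∪ P i,
            (touchGraph (lexProd G H) S' (D' (.inl (i, h)))).Reachable
              (v, if v = u₁ then c else if v = u₂ then b else h) (u₂, b) := by
          intro c hc v hv
          have hr := hP.conn i v hv u₂ (Or.inl (by simp))
          rw [sup_bot_eq] at hr
          have := touchGraph_reachable_map (Γ := lexProd G H) (S' := S') (D' := D' (.inl (i, h)))
            (fun v => (v, if v = u₁ then c else if v = u₂ then b else h))
            (fun _ _ h => Or.inl h) ?_ ?_ hr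
          · simpa [hu.symm] using this
          · rintro x (rfl | rfl)
            · simpa using hc
            · simpa [hu.symm] using (mem2 b).2 rfl
          · intro x hx
            simp only [(hPu i x hx).1, (hPu i x hx).2, if_false]
            exact ⟨hx, rfl⟩
        refine reachable_all_of_base (u₂, b) ?_
        rintro p ((rfl | rfl | rfl) | ⟨h1, h2⟩)
        · simpa using hmap a (by simp [hS']) u₁ (by simp)
        · simpa using hmap a' (by simp [hS']) u₁ (by simp)
        · exact Reachable.refl _
        · have := hmap a (by simp [hS']) p.1 (Or.inr h1)
          simp only [(hPu i _ h1).1, (hPu i _ h1).2, if_false] at this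
          rwa [show (p.1, h) = p from Prod.ext rfl h2.symm] at this
      · have aS : (u₁, a) ∈ S' := by simp [hS']
        have aS' : (u₁, a') ∈ S' := by simp [hS']
        have bS : (u₂, b) ∈ S' := by simp [hS']
        refine reachable_all_of_base (u₂, b) ?_
        have hE : ∀ p q : V × W, (lexProd G H).Adj p q → p ∈ S' ∪ D' (.inr ⟨h, hadj⟩) →
            q ∈ S' ∪ D' (.inr ⟨h, hadj⟩) →
            (p ∈ D' (.inr ⟨h, hadj⟩) ∨ q ∈ D' (.inr ⟨h, hadj⟩)) →
            (touchGraph (lexProd G H) S' (D' (.inr ⟨h, hadj⟩)) ⊔ F' (.inr ⟨h, hadj⟩)).Reachable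
              p q := fun p q h1 h2 h3 h4 =>
          Adj.reachable (Or.inl ⟨h1, h2, h3, h4⟩)
        by_cases hb : h = b
        · have hF : ∀ c, (u₁, c) ∈ S' → (touchGraph (lexProd G H) S' (D' (.inr ⟨h, hadj⟩)) ⊔
              F' (.inr ⟨h, hadj⟩)).Reachable (u₁, c) (u₂, b) := fun c hc =>
            Adj.reachable (Or.inr ⟨hb, hc, bS, hadj⟩)
          rintro p ((rfl | rfl | rfl) | ⟨h1, h2⟩)
          · exact hF a aS
          · exact hF a' aS'
          · exact Reachable.refl _
          · exfalso
            rcases h1 with rfl | rfl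
            exacts [h2 ((mem2 _).2 hb), h2 ((mem1 _).2 (Or.inl hb))]
        · have hD2 : (u₂, h) ∈ D' (.inr ⟨h, hadj⟩) :=
            ⟨Or.inl rfl, fun h' => hb ((mem2 _).1 h')⟩
          have hmid : (touchGraph (lexProd G H) S' (D' (.inr ⟨h, hadj⟩)) ⊔
              F' (.inr ⟨h, hadj⟩)).Reachable (u₂, h) (u₂, b) := by
            by_cases hb' : h = b'
            · subst hb'
              exact hE _ _ (Or.inr ⟨rfl, hbb'.symm⟩) (Or.inr hD2) (Or.inl bS) (Or.inl hD2)
            · have hD1 : (u₁, π h) ∈ D' (.inr ⟨h, hadj⟩) :=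
                ⟨Or.inr rfl, fun h' => ((mem1 _).1 h').elim hb hb'⟩
              exact (hE _ (u₁, π h) (Or.inl hadj.symm) (Or.inr hD2) (Or.inr hD1)
                (Or.inl hD2)).trans
                (hE _ _ (Or.inl hadj) (Or.inr hD1) (Or.inl bS) (Or.inl hD1))
          have hside : ∀ c, (u₁, c) ∈ S' ∪ D' (.inr ⟨h, hadj⟩) →
              (touchGraph (lexProd G H) S' (D' (.inr ⟨h, hadj⟩)) ⊔
              F' (.inr ⟨h, hadj⟩)).Reachable (u₁, c) (u₂, b) := fun c hc =>
            (hE _ (u₂, h) (Or.inl hadj) hc (Or.inr hD2) (Or.inr hD2)).trans hmid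
          rintro p (hp | hp)
          · have hp' := hp
            rcases hp' with rfl | rfl | rfl
            · exact hside a (Or.inl aS)
            · exact hside a' (Or.inl aS')
            · exact Reachable.refl _
          · obtain ⟨rfl | rfl, h2⟩ := id hp
            · exact hmid
            · exact hside _ (Or.inr hp)
  have := hP'.card_le_localConn ⟨(u₁, a), by simp [hS'], (u₁, a'), by simp [hS'],
    fun h => ha (congrArg Prod.snd h)⟩
  refine le_trans (le_of_eq ?_) this
  by_cases hadj : G.Adj u₁ u₂
  · simp [hadj, add_mul]
  · simp [hadj]

/-- Any vertices in one layer. -/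
theorem mul_card_le_localConn_lexProd_of_layer [Fintype V] [Fintype W] (G : SimpleGraph V)
    (H : SimpleGraph W) (u : V) (N : Finset V) (hN : ∀ v ∈ N, G.Adj u v) {S : Set (V × W)}
    (hS : S.Nontrivial) (hSu : ∀ p ∈ S, p.1 = u) :
    N.card * Fintype.card W ≤ localConn (lexProd G H) S := by
  have hadj : ∀ i : N × W, ∀ p ∈ S, (lexProd G H).Adj p (i.1.1, i.2) := by
    intro i p hp
    refine Or.inl ?_
    rw [hSu p hp]
    exact hN _ i.1.2
  have hP : IsPacking (lexProd G H) S (fun i : N × W => {(i.1.1, i.2)}) (fun _ => ⊥) := by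
    refine ⟨?_, ?_, fun _ _ _ h => h.elim, fun _ _ _ _ h => h.elim, ?_⟩
    · rintro i p rfl hp
      exact (hadj i _ hp).ne rfl
    · rintro i j p rfl h
      simp only [Set.mem_singleton_iff, Prod.mk.injEq] at h
      exact Prod.ext (Subtype.ext h.1) h.2
    · intro i
      rw [sup_bot_eq]
      refine reachable_all_of_base (i.1.1, i.2) ?_
      rintro p (hp | rfl)
      · exact Adj.reachable ⟨hadj i p hp, Or.inl hp, Or.inr rfl, Or.inr rfl⟩
      · exact Reachable.refl _
  simpa using hP.card_le_localConn hS

/-! ### Cut bounds for `genConn` and the main inequality -/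

lemma genConn_le_localConn [Fintype V] {k : ℕ} {G : SimpleGraph V} (hG : G.Connected)
    {S : Finset V} (hS : S.card = k) : genConn k G ≤ localConn G (S : Set V) := by
  unfold genConn
  rw [if_pos hG, if_pos (hS.ge.trans (Finset.card_le_univ S))]
  exact Nat.sInf_le ⟨S, hS, rfl⟩

lemma le_genConn [Fintype V] {k n : ℕ} {G : SimpleGraph V} (hG : G.Connected)
    (hk : k ≤ Fintype.card V) (h : ∀ S : Finset V, S.card = k → n ≤ localConn G (S : Set V)) :
    n ≤ genConn k G := by
  unfold genConn
  rw [if_pos hG, if_pos hk]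
  obtain ⟨S, -, hS⟩ := Finset.exists_subset_card_eq (s := (Finset.univ : Finset V)) (n := k)
    (by rwa [Finset.card_univ])
  refine le_csInf ⟨_, S, hS, rfl⟩ ?_
  rintro _ ⟨S, hS, rfl⟩
  exact h S hS

lemma genConn_eq_one_of_card_lt [Fintype V] {k : ℕ} {G : SimpleGraph V} (hG : G.Connected)
    (hk : Fintype.card V < k) : genConn k G = 1 := by
  unfold genConn
  rw [if_pos hG, if_neg (not_le.2 hk)]

lemma genConn_three_le [Fintype V] {G : SimpleGraph V} (hG : G.Connected) {a b c : V}
    (hab : a ≠ b) (hac : a ≠ c) (hbc : b ≠ c) : genConn 3 G ≤ localConn G {a, b, c} := by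
  classical
  have := genConn_le_localConn (S := {a, b, c}) hG
    (Finset.card_eq_three.2 ⟨a, b, c, hab, hac, hbc, rfl⟩)
  simpa using this

lemma one_le_genConn_three [Fintype V] {G : SimpleGraph V} (hG : G.Connected) :
    1 ≤ genConn 3 G := by
  by_cases hV : 3 ≤ Fintype.card V
  · refine le_genConn hG hV fun S hS => ?_
    have hP : IsPacking G (S : Set V) (fun _ : Unit => (S : Set V)ᶜ) (fun _ : Unit =>
        { Adj := fun x y => G.Adj x y ∧ x ∈ S ∧ y ∈ S
          symm := ⟨fun x y h => ⟨h.1.symm, h.2.2, h.2.1⟩⟩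
          loopless := ⟨fun x h => G.loopless.irrefl _ h.1⟩ }) := by
      refine ⟨fun _ _ h => h, fun _ _ _ _ _ => rfl, fun _ _ _ h => h, fun _ _ _ _ _ _ => rfl, ?_⟩
      intro _ x _ y _
      refine (hG.preconnected x y).mono ?_
      intro p q hpq
      by_cases hp : p ∈ S <;> by_cases hq : q ∈ S
      · exact Or.inr ⟨hpq, hp, hq⟩
      · exact Or.inl ⟨hpq, Or.inl hp, Or.inr hq, Or.inr hq⟩
      · exact Or.inl ⟨hpq, Or.inr hp, Or.inl hq, Or.inl hp⟩
      · exact Or.inl ⟨hpq, Or.inr hp, Or.inr hq, Or.inl hp⟩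
    have hS' : (S : Set V).Nontrivial := by
      rw [← Set.one_lt_ncard_iff_nontrivial, Set.ncard_coe_finset]
      omega
    simpa using hP.card_le_localConn hS'
  · exact (genConn_eq_one_of_card_lt hG (not_le.1 hV)).ge

lemma localConn_le_of_boundary [Finite V] {G : SimpleGraph V} {S A : Set V} {s t : V}
    (hs : s ∈ S) (ht : t ∈ S) (hsA : s ∈ A) (htA : t ∉ A) (C : Finset V)
    (hC : ∀ p ∈ A, ∀ q ∉ A, G.Adj p q → q ∈ C)
    (hu : ∀ q ∈ S, q ∉ A → ∀ p ∈ A, ∀ p' ∈ A, G.Adj p q → G.Adj p' q → p = p') :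
    localConn G S ≤ C.card := by
  obtain ⟨D, F, hP⟩ := exists_packing_of_le_localConn (le_refl (localConn G S))
  simpa using hP.card_le_of_boundary hs ht hsA htA C hC hu

open Classical in
/-- A set separating `u₁` from `u₂`, after removal of a possible edge `u₁u₂`, is large. -/
lemma genConn_three_le_card_cut [Fintype V] {G : SimpleGraph V} (hG : G.Connected) {u₁ u₂ : V}
    (hu : u₁ ≠ u₂) (Y : Finset V) (h₂ : u₂ ∉ Y)
    (hY : ∀ y ∈ Y, ¬ G.Adj y u₂) :
    genConn 3 G ≤ (Finset.univ.filter fun v => v ≠ u₁ ∧ v ≠ u₂ ∧ v ∉ Y ∧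
      (G.Adj u₁ v ∨ ∃ y ∈ Y, G.Adj y v)).card + if G.Adj u₁ u₂ then 1 else 0 := by
  set C := Finset.univ.filter fun v => v ≠ u₁ ∧ v ≠ u₂ ∧ v ∉ Y ∧
      (G.Adj u₁ v ∨ ∃ y ∈ Y, G.Adj y v) with hCdef
  let E : Finset V := if G.Adj u₁ u₂ then {u₂} else ∅
  have hE : E.card = if G.Adj u₁ u₂ then 1 else 0 := by
    by_cases h : G.Adj u₁ u₂ <;> simp [E, h]
  let A : Set V := {v | v = u₁ ∨ v ∈ Y}
  have h1A : u₁ ∈ A := Or.inl rfl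
  have h2A : u₂ ∉ A := fun h => h.elim (fun h => hu h.symm) h₂
  have hbd : ∀ p ∈ A, ∀ q ∉ A, G.Adj p q → q ∈ C ∪ E := by
    intro p hp q hq hpq
    rw [Finset.mem_union]
    by_cases hq2 : q = u₂
    · subst hq2
      rcases hp with rfl | hp
      · right
        simp [E, hpq]
      · exact absurd hpq (hY p hp)
    · left
      simp only [hCdef, Finset.mem_filter, Finset.mem_univ, true_and]
      refine ⟨fun h => hq (Or.inl h), hq2, fun h => hq (Or.inr h), ?_⟩
      rcases hp with rfl | hp
      exacts [Or.inl hpq, Or.inr ⟨p, hp, hpq⟩]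
  have hcard : (C ∪ E).card ≤ C.card + if G.Adj u₁ u₂ then 1 else 0 :=
    hE ▸ Finset.card_union_le _ _
  refine le_trans ?_ hcard
  by_cases hV : 3 ≤ Fintype.card V
  · obtain ⟨u₃, h31, h32, h3⟩ : ∃ u₃, u₁ ≠ u₃ ∧ u₂ ≠ u₃ ∧ (u₃ ∉ C ∨ ∀ v, v ∉ Y ∨ v = u₁) := by
      by_cases h : ∃ u₃, u₁ ≠ u₃ ∧ u₂ ≠ u₃ ∧ u₃ ∉ C
      · obtain ⟨u₃, h1, h2, h3⟩ := h
        exact ⟨u₃, h1, h2, Or.inl h3⟩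
      · push Not at h
        obtain ⟨u₃, -, h3⟩ := Finset.exists_mem_notMem_of_card_lt_card
          (s := {u₁, u₂}) (t := (Finset.univ : Finset V))
          (by rw [Finset.card_univ]; exact lt_of_le_of_lt Finset.card_le_two hV)
        simp only [Finset.mem_insert, Finset.mem_singleton, not_or] at h3
        refine ⟨u₃, fun h => h3.1 h.symm, fun h => h3.2 h.symm, Or.inr fun v => ?_⟩
        by_cases hv1 : v = u₁
        · exact Or.inr hv1
        by_cases hv2 : v = u₂
        · exact Or.inl (hv2 ▸ h₂)
        · have := h v (fun h => hv1 h.symm) (fun h => hv2 h.symm)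
          simp only [hCdef, Finset.mem_filter] at this
          exact Or.inl this.2.2.2.1
    refine (genConn_three_le hG hu h31 h32).trans (localConn_le_of_boundary (s := u₁) (t := u₂)
      (A := A) (by simp) (by simp) h1A h2A _ hbd ?_)
    have hp1 : ∀ q, (q = u₂ ∨ q = u₃) → q ∉ A → ∀ p ∈ A, G.Adj p q → p = u₁ := by
      rintro q (rfl | rfl) hq p hp hpq
      · exact hp.resolve_right fun h => hY p h hpq
      · rcases h3 with h3 | h3
        · have := hbd p hp q hq hpq
          rw [Finset.mem_union] at this
          have hqE := this.resolve_left h3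
          by_cases h : G.Adj u₁ u₂
          · simp only [E, h, if_true, Finset.mem_singleton] at hqE
            exact absurd hqE.symm h32
          · simp [E, h] at hqE
        · rcases hp with hp | hp
          exacts [hp, (h3 p).resolve_left (fun h => h hp)]
    rintro q (rfl | hq) hqA p hp p' hp' hpq hpq'
    · exact absurd h1A hqA
    · exact (hp1 q hq hqA p hp hpq).trans (hp1 q hq hqA p' hp' hpq').symm
  · rw [genConn_eq_one_of_card_lt hG (not_le.1 hV)]
    obtain ⟨p, q, hpq, hp, hq⟩ := exists_boundary_adj (hG.preconnected u₁ u₂) A h1A h2A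
    exact Finset.card_pos.2 ⟨q, hbd p hp q hq hpq⟩

lemma lexProd_connected {G : SimpleGraph V} {H : SimpleGraph W} (hG : G.Connected)
    (hH : H.Connected) : (lexProd G H).Connected := by
  have := hG.nonempty
  have := hH.nonempty
  refine ⟨fun p q => ?_⟩
  have h1 : (lexProd G H).Reachable p (p.1, q.2) :=
    (hH.preconnected p.2 q.2).map (G' := lexProd G H)
      ⟨fun w => (p.1, w), fun h => Or.inr ⟨rfl, h⟩⟩
  have h2 : (lexProd G H).Reachable (p.1, q.2) q :=
    (hG.preconnected p.1 q.1).map (G' := lexProd G H)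
      ⟨fun v => (v, q.2), fun h => Or.inl h⟩
  exact h1.trans h2

open Classical in
theorem genConn_three_mul_card_le_of_pair [Fintype V] [Fintype W] {G : SimpleGraph V}
    {H : SimpleGraph W} (hG : G.Connected) (hH : H.Connected) {u₁ u₂ : V} (hu : u₁ ≠ u₂)
    {a a' b : W} (ha : a ≠ a') :
    genConn 3 G * Fintype.card W ≤ localConn (lexProd G H) {(u₁, a), (u₁, a'), (u₂, b)} := by
  obtain ⟨P, hP⟩ := exists_packing_pair G (u₁ := u₁) (u₂ := u₂)
    (genConn 3 G - if G.Adj u₁ u₂ then 1 else 0) (by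
      intro Y _ h2 hY
      have := genConn_three_le_card_cut hG hu Y h2 hY
      rwa [tsub_le_iff_right])
  exact le_trans (Nat.mul_le_mul_right _ le_tsub_add)
    (mul_card_le_localConn_lexProd_of_pair G hH hu ha hP)

-- The cut bound with `Y = ∅`: the boundary of `{u}` is its neighbourhood.
open Classical in
lemma genConn_three_le_degree [Fintype V] {G : SimpleGraph V} (hG : G.Connected)
    (hV : 2 ≤ Fintype.card V) (u : V) :
    genConn 3 G ≤ (Finset.univ.filter fun v => G.Adj u v).card := by
  obtain ⟨w, hw⟩ := Fintype.exists_ne_of_one_lt_card hV u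
  have h := genConn_three_le_card_cut hG hw.symm ∅ (by simp) (by simp)
  refine h.trans ?_
  by_cases huw : G.Adj u w
  · rw [if_pos huw]
    refine Finset.card_lt_card ((Finset.ssubset_iff_of_subset ?_).2 ⟨w, by simpa using huw, ?_⟩)
    · intro v
      simp
    · simp
  · rw [if_neg huw]
    refine Finset.card_le_card ?_
    intro v
    simp

theorem genConn_three_mul_card_le [Fintype V] [Fintype W] {G : SimpleGraph V}
    {H : SimpleGraph W} (hG : G.Connected) (hH : H.Connected) (hV : 2 ≤ Fintype.card V) :
    genConn 3 G * Fintype.card W ≤ genConn 3 (lexProd G H) := by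
  classical
  have hΓ := lexProd_connected hG hH
  have hW : 0 < Fintype.card W := Fintype.card_pos_iff.2 hH.nonempty
  by_cases hVW : 3 ≤ Fintype.card (V × W)
  · refine le_genConn hΓ hVW fun S hS => ?_
    obtain ⟨⟨u₁, a⟩, ⟨u₂, b⟩, ⟨u₃, c⟩, h12, h13, h23, rfl⟩ := Finset.card_eq_three.1 hS
    simp only [Finset.coe_insert, Finset.coe_singleton]
    simp only [ne_eq, Prod.mk.injEq, not_and] at h12 h13 h23
    by_cases e12 : u₁ = u₂
    · subst e12
      by_cases e13 : u₁ = u₃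
      · subst e13
        refine le_trans (Nat.mul_le_mul_right _ (genConn_three_le_degree hG hV u₁))
          (mul_card_le_localConn_lexProd_of_layer G H u₁ _ (by simp) ?_ ?_)
        · exact ⟨(u₁, a), by simp, (u₁, b), by simp, fun h => h12 rfl (congrArg Prod.snd h)⟩
        · rintro p (rfl | rfl | rfl) <;> rfl
      · exact genConn_three_mul_card_le_of_pair hG hH e13 (h12 rfl)
    · by_cases e13 : u₁ = u₃
      · subst e13
        rw [Set.pair_comm]
        exact genConn_three_mul_card_le_of_pair hG hH e12 (h13 rfl)
      · by_cases e23 : u₂ = u₃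
        · subst e23
          rw [Set.insert_comm, Set.pair_comm]
          exact genConn_three_mul_card_le_of_pair hG hH (Ne.symm e12) (h23 rfl)
        · have := mul_card_le_localConn_lexProd_of_section G H
            (fun v => if v = u₁ then a else if v = u₂ then b else c) e12 e23 e13
            (genConn_three_le hG e12 e13 e23)
          simpa [Set.image_insert_eq, Ne.symm e12, Ne.symm e13, Ne.symm e23] using this
  · rw [Fintype.card_prod] at hVW
    -- Fewer than three vertices in the product, with at least two in `G`, leaves only `|V| = 2` and
    -- `|W| = 1`.
    have hW1 : Fintype.card W = 1 := by nlinarith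
    rw [hW1] at hVW
    rw [hW1, genConn_eq_one_of_card_lt hG (by omega)]
    exact one_le_genConn_three hΓ

/-! ### Sharpness for paths -/

lemma genConn_three_pathGraph {n : ℕ} (hn : 3 ≤ n) : genConn 3 (pathGraph n) = 1 := by
  obtain ⟨n, rfl⟩ : ∃ m, n = m + 3 := ⟨n - 3, by omega⟩
  have hG := pathGraph_connected (n + 2)
  refine le_antisymm ?_ (one_le_genConn_three hG)
  have h := genConn_three_le hG (a := ⟨0, by omega⟩) (b := ⟨1, by omega⟩) (c := ⟨2, by omega⟩)
    (by simp) (by simp) (by simp)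
  refine h.trans (localConn_le_of_boundary (s := ⟨0, by omega⟩) (t := ⟨1, by omega⟩)
    (A := {⟨0, by omega⟩}) (by simp) (by simp) rfl (by simp) {⟨1, by omega⟩} ?_ ?_)
  · rintro p rfl q - hpq
    rw [pathGraph_adj] at hpq
    simp only [Finset.mem_singleton, Fin.ext_iff]
    simp only at hpq
    omega
  · rintro q - - p rfl p' rfl - -
    rfl

lemma genConn_three_lexProd_pathGraph_le [Fintype W] {n : ℕ} (hn : 3 ≤ n) {H : SimpleGraph W}
    (hH : H.Connected) : genConn 3 (lexProd (pathGraph n) H) ≤ Fintype.card W := by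
  classical
  obtain ⟨n, rfl⟩ : ∃ m, n = m + 3 := ⟨n - 3, by omega⟩
  have hΓ := lexProd_connected (pathGraph_connected (n + 2)) hH
  obtain ⟨w⟩ := hH.nonempty
  let v₀ : Fin (n + 3) := ⟨0, by omega⟩
  let v₁ : Fin (n + 3) := ⟨1, by omega⟩
  let v₂ : Fin (n + 3) := ⟨2, by omega⟩
  have h01 : v₀ ≠ v₁ := by simp [v₀, v₁]
  have h02 : v₀ ≠ v₂ := by simp [v₀, v₂]
  have h12 : v₁ ≠ v₂ := by simp [v₁, v₂]
  let C : Finset (Fin (n + 3) × W) := Finset.univ.image fun w => (v₁, w)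
  have hC : C.card = Fintype.card W := by
    rw [Finset.card_image_of_injective _ (fun _ _ h => congrArg Prod.snd h), Finset.card_univ]
  have hbd : ∀ p ∈ {p : Fin (n + 3) × W | p.1 = v₀}, ∀ q ∉ {p : Fin (n + 3) × W | p.1 = v₀},
      (lexProd (pathGraph (n + 3)) H).Adj p q → q.1 = v₁ := by
    rintro ⟨p, x⟩ hp ⟨q, y⟩ hq h
    simp only [Set.mem_ofPred_eq] at hp hq
    subst hp
    rcases h with h | h
    · rw [pathGraph_adj] at h
      simp only [v₀, v₁, Fin.ext_iff] at h ⊢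
      omega
    · exact absurd h.1.symm hq
  have hbdC : ∀ p ∈ {p : Fin (n + 3) × W | p.1 = v₀}, ∀ q ∉ {p : Fin (n + 3) × W | p.1 = v₀},
      (lexProd (pathGraph (n + 3)) H).Adj p q → q ∈ C := fun p hp q hq h =>
    Finset.mem_image.2 ⟨q.2, Finset.mem_univ _, Prod.ext (hbd p hp q hq h).symm rfl⟩
  rw [← hC]
  -- Two terminals in the end layer and one at distance two keep the separating layer free of
  -- terminals. If `|W| = 1` a terminal must be in that layer or beyond, but the end layer is then a
  -- single vertex and sends one edge to each boundary vertex.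
  by_cases hW : ∃ w', w' ≠ w
  · obtain ⟨w', hw⟩ := hW
    refine (genConn_three_le hΓ (a := (v₀, w)) (b := (v₀, w')) (c := (v₂, w))
      (by simpa using hw.symm) (by simp [h02]) (by simp [h02])).trans
      (localConn_le_of_boundary (s := (v₀, w)) (t := (v₂, w)) (by simp) (by simp)
        (rfl : (v₀, w).1 = v₀) (fun h => h02 (Eq.symm h)) C hbdC ?_)
    rintro q (rfl | rfl | rfl) hq p hp p' hp' hpq -
    · exact absurd rfl hq
    · exact absurd rfl hq
    · exact absurd (hbd p hp _ hq hpq).symm h12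
  · push Not at hW
    refine (genConn_three_le hΓ (a := (v₀, w)) (b := (v₁, w)) (c := (v₂, w))
      (by simp [h01]) (by simp [h02]) (by simp [h12])).trans
      (localConn_le_of_boundary (s := (v₀, w)) (t := (v₂, w)) (by simp) (by simp)
        (rfl : (v₀, w).1 = v₀) (fun h => h02 (Eq.symm h)) C hbdC ?_)
    rintro q - - p hp p' hp' - -
    exact Prod.ext (Eq.trans hp (Eq.symm hp')) ((hW _).trans (hW _).symm)

lemma genConn_three_lexProd_pathGraph [Fintype W] {n : ℕ} (hn : 3 ≤ n) {H : SimpleGraph W}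
    (hH : H.Connected) : genConn 3 (lexProd (pathGraph n) H) = Fintype.card W := by
  refine le_antisymm (genConn_three_lexProd_pathGraph_le hn hH) ?_
  obtain ⟨n, rfl⟩ : ∃ m, n = m + 3 := ⟨n - 3, by omega⟩
  have := genConn_three_mul_card_le (pathGraph_connected (n + 2)) hH (by simp)
  rwa [genConn_three_pathGraph hn, one_mul] at this

end SteinerConn

theorem theorem1p11 :
    (∀ (V W : Type*) [Fintype V] [Fintype W] (G : SimpleGraph V) (H : SimpleGraph W),
      G.Connected → H.Connected → 2 ≤ Fintype.card V →
        SteinerConn.genConn 3 G * Fintype.card W ≤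
          SteinerConn.genConn 3 (SteinerConn.lexProd G H)) ∧
    (∀ n : ℕ, 4 ≤ n →
      SteinerConn.genConn 3
          (SteinerConn.lexProd (SimpleGraph.pathGraph n) (SimpleGraph.pathGraph 3)) =
        SteinerConn.genConn 3 (SimpleGraph.pathGraph n) * Fintype.card (Fin 3) ∧
      SteinerConn.genConn 3 (SimpleGraph.pathGraph n) * Fintype.card (Fin 3) = 3) ∧
    (∀ n m : ℕ, 3 ≤ n → 1 ≤ m →
      SteinerConn.genConn 3
          (SteinerConn.lexProd (SimpleGraph.pathGraph n) (SimpleGraph.completeGraph (Fin m))) =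
        SteinerConn.genConn 3 (SimpleGraph.pathGraph n) * Fintype.card (Fin m) ∧
      SteinerConn.genConn 3 (SimpleGraph.pathGraph n) * Fintype.card (Fin m) = m) := by
  refine ⟨fun V W _ _ G H hG hH hV => SteinerConn.genConn_three_mul_card_le hG hH hV,
    fun n hn => ?_, fun n m hn hm => ?_⟩
  · rw [SteinerConn.genConn_three_pathGraph (by omega),
      SteinerConn.genConn_three_lexProd_pathGraph (by omega) (SimpleGraph.pathGraph_connected 2)]
    simp
  · have : Nonempty (Fin m) := ⟨⟨0, hm⟩⟩
    rw [SteinerConn.genConn_three_pathGraph hn,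
      SteinerConn.genConn_three_lexProd_pathGraph hn SimpleGraph.connected_top]
    simp
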